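/- **Setting.** Let $\mathbb T\subseteq\mathbb R_+^d\times\mathbb R_+$ be a technology with free disposability (if $(x,y)\in\mathbb T$, $x'\ge x$ and $0\le y'\le y$, then $(x',y')\in\mathbb T$). Let $(X_i,Y_i)_{i\ge1}$ be i.i.d. random pairs with values in $\mathbb T$, fix $x\in\mathbb R_+^d$, and assume $p_0=P(X_1\le x)>0$ (componentwise order). Put $F(y)=P(Y_1\le y\mid X_1\le x)$, $q(\tau)=\inf\{y:F(y)\ge\tau\}$, so that $q(1)$ is the upper endpoint of $F$. Assume that $q(1)$ is finite and that, for some $\xi_0<0$ and all $v>0$, $$\frac{1-F(q(1)-vz)}{1-F(q(1)-z)}\to v^{-1/\xi_0}\qquad (z\downarrow0).$$ For $\tau\in(0,1)$ let $\hat q_n(\tau)$ be any measurable minimizer of $q\mapsto\sum_{i=1}^n(\tau-1\{Y_i\le q\})(Y_i-q)1\{X_i\le x\}$. Fix $k_0>0$, $m>1$, $L\ge1$ and $k_1,\dots,k_L>0$ such that $mk_0p_0>k_0p_0+1$ and none of $k_0p_0,\,mk_0p_0,\,k_1p_0,\dots,k_Lp_0$ is an integer. Put $\hat\alpha_n=(\hat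 q_n(1-k_0/n)-\hat q_n(1-mk_0/n))^{-1}$ and $\tau_{nl}=1-k_l/n$. For $\xi<0$, $p>0$, $k>0$ let $h(k)=\lceil kp\rceil$, let $\mathcal E_1,\mathcal E_2,\dots$ be i.i.d. standard exponential, and put $$Z_\infty(k)=-\Big(\sum_{i=1}^{h(k)}\mathcal E_i/p\Big)^{-\xi},\qquad \tilde Z_\infty(k)=\frac{Z_\infty(k)}{Z_\infty(k_0)-Z_\infty(mk_0)} .$$ Assume that at $p=p_0$ the integers $h(k_0),h(mk_0),h(k_1),\dots,h(k_L)$ are distinct. For $(\xi,p)$ in a neighbourhood of $(\xi_0,p_0)$ let $f(\cdot;\xi,p)\ge0$ be a joint density of $(\tilde Z_\infty(k_1),\dots,\tilde Z_\infty(k_L))$ under the parameter $(\xi,p)$. Below, $\tilde Z_\infty(k_l)$ without a parameter is taken at $(\xi_0,p_0)$. **Assumptions.** 1. The loss $\rho:\mathbb R\to[0,\infty)$ is convex and $\rho(u)\le C(1+|u|^B)$ for some constants $C$ and $B\ge0$. 2. $\hat\xi_n\to\xi_0$ and $\hat p_n\to p_0$ in probability. 3. $(z,\xi,p)\mapsto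 f(z;\xi,p)$ is continuous at $(z,\xi_0,p_0)$ for every $z\in\mathbb R^L$, and there are $r>B+1$, $C$ and a neighbourhood $N$ of $(\xi_0,p_0)$ with $f(z;\xi,p)\le C(1+|z_l|)^{-r}$ for all $z\in\mathbb R^L$, $l=1,\dots,L$, $(\xi,p)\in N$. 4. The prior density $\pi\ge0$ (possibly improper) is measurable, bounded and continuous at $q(1)$, and $q(1)$ is an interior point of $U=\{\pi>0\}$. 5. With $$Q_\infty(z,w)=\int_{\mathbb R}\rho(z-v)\frac{f(w_1-v,\dots,w_L-v;\xi_0,p_0)}{\int_{\mathbb R} f(w_1-v',\dots,w_L-v';\xi_0,p_0)\,dv'}\,dv\in[0,\infty],$$ almost surely $z\mapsto Q_\infty(z,(\tilde Z_\infty(k_1),\dots,\tilde Z_\infty(k_L)))$ is finite on a fixed nonempty open set and is uniquely minimized over $\mathbb R$ at a random variable $Z_\infty^{BE}$. **Estimator.** Let $\hat q_n^{BE}$ be any random variable that, with probability tending to one as $n\to\infty$, minimizes over $q\in\mathbb R$ the average risk $$\int_U\rho\big(\hat\alpha_n(q-\bar q)\big)\,\frac{f\big(\hat\alpha_n(\hat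 q_n(\tau_{n1})-\bar q),\dots,\hat\alpha_n(\hat q_n(\tau_{nL})-\bar q);\hat\xi_n,\hat p_n\big)\,\pi(\bar q)}{\int_U f\big(\hat\alpha_n(\hat q_n(\tau_{n1})-q'),\dots,\hat\alpha_n(\hat q_n(\tau_{nL})-q');\hat\xi_n,\hat p_n\big)\,\pi(q')\,dq'}\,d\bar q .$$ **Theorem.** Then $\hat\alpha_n(\hat q_n^{BE}-q(1))$ converges in distribution to $Z_\infty^{BE}$ as $n\to\infty$. -/

import Mathlib

open MeasureTheory ProbabilityTheory Filter Topology
open scoped ENNReal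

noncomputable section

namespace Frontier

/-- A technology with `d` inputs and one output: a set of feasible pairs of nonnegative
inputs and nonnegative output. -/
def IsTechnology {d : ℕ} (T : Set ((Fin d → ℝ) × ℝ)) : Prop :=
  ∀ w ∈ T, 0 ≤ w.1 ∧ 0 ≤ w.2

/-- Free disposability: more input and less (nonnegative) output remains feasible. -/
def FreeDisposal {d : ℕ} (T : Set ((Fin d → ℝ) × ℝ)) : Prop :=
  ∀ x x' : Fin d → ℝ, ∀ y y' : ℝ, (x, y) ∈ T → x ≤ x' → 0 ≤ y' → y' ≤ y → (x', y') ∈ T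

section Sample

variable {Ω : Type*} [MeasurableSpace Ω] {d : ℕ}

/-- `P (X ≤ x)`, with the componentwise order. -/
def probInput (P : Measure Ω) (X : Ω → Fin d → ℝ) (x : Fin d → ℝ) : ℝ :=
  P.real {ω | X ω ≤ x}

/-- The conditional distribution function `F (y / x) = P (Y ≤ y | X ≤ x)`. -/
def outputCDF (P : Measure Ω) (X : Ω → Fin d → ℝ) (Y : Ω → ℝ) (x : Fin d → ℝ) (y : ℝ) : ℝ :=
  (ProbabilityTheory.cond P {ω | X ω ≤ x}).real {ω | Y ω ≤ y}

/-- The quantile function of a distribution function; `quantile F 1` is the upper endpoint. -/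
def quantile (F : ℝ → ℝ) (τ : ℝ) : ℝ := sInf {y | τ ≤ F y}

/-- `F` belongs to the domain of attraction of the type III generalized extreme value
distributions with index `ξ < 0`; the upper endpoint of `F` is finite. -/
def InTypeIIIDomain (F : ℝ → ℝ) (ξ : ℝ) : Prop :=
  ξ < 0 ∧ BddAbove {z | F z < 1} ∧
    ∀ v : ℝ, 0 < v →
      Tendsto (fun z : ℝ =>
          (1 - F (sSup {z | F z < 1} - v * z)) / (1 - F (sSup {z | F z < 1} - z)))
        (𝓝[>] 0) (𝓝 (v ^ (-1 / ξ)))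

/-- The check function `(τ - 1{u ≤ 0}) u`. -/
def checkFun (τ u : ℝ) : ℝ := (τ - Set.indicator (Set.Iic (0 : ℝ)) 1 u) * u

/-- The quantile objective `∑_{i < n} checkFun τ (Y i - q) 1{X i ≤ x}` of the first `n`
observations. -/
def quantileObjective (X : ℕ → Ω → Fin d → ℝ) (Y : ℕ → Ω → ℝ) (x : Fin d → ℝ)
    (n : ℕ) (τ : ℝ) (ω : Ω) (q : ℝ) : ℝ :=
  ∑ i ∈ Finset.range n, Set.indicator {ω | X i ω ≤ x} (fun ω => checkFun τ (Y i ω - q)) ω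

/-- `qhat n τ` is a (measurable) minimizer of the quantile objective, for every sample size and
every level `τ ∈ (0, 1)`. The minimizer need not be unique; any selection is allowed. -/
def IsQuantileEstimator (P : Measure Ω) (X : ℕ → Ω → Fin d → ℝ) (Y : ℕ → Ω → ℝ)
    (x : Fin d → ℝ) (qhat : ℕ → ℝ → Ω → ℝ) : Prop :=
  (∀ n τ, AEMeasurable (qhat n τ) P) ∧
    ∀ n, ∀ τ ∈ Set.Ioo (0 : ℝ) 1, ∀ᵐ ω ∂P, ∀ q,
      quantileObjective X Y x n τ ω (qhat n τ ω) ≤ quantileObjective X Y x n τ ω q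

/-- The feasible normalizing factor `(qhat (1 - k₀/n) - qhat (1 - m k₀/n))⁻¹`. -/
def alphaHat (qhat : ℕ → ℝ → Ω → ℝ) (k₀ m : ℝ) (n : ℕ) (ω : Ω) : ℝ :=
  (qhat n (1 - k₀ / n) ω - qhat n (1 - m * k₀ / n) ω)⁻¹

end Sample

section Limit

variable {Ω' : Type*}

/-- `h(k)`: the integer with `k p ≤ h(k) ≤ k p + 1`, unique when `k p > 0` is not an integer. -/
def hIndex (p k : ℝ) : ℕ := ⌈k * p⌉₊

/-- `Z_∞(k) = -((E_1 + ⋯ + E_{h(k)}) / p) ^ (-ξ)`. -/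
def limitZ (E : ℕ → Ω' → ℝ) (θ : ℝ × ℝ) (k : ℝ) (ω : Ω') : ℝ :=
  -((∑ i ∈ Finset.range (hIndex θ.2 k), E i ω / θ.2) ^ (-θ.1))

/-- `Z̃_∞(k) = Z_∞(k) / (Z_∞(k₀) - Z_∞(m k₀))`. -/
def limitZTilde (E : ℕ → Ω' → ℝ) (k₀ m : ℝ) (θ : ℝ × ℝ) (k : ℝ) (ω : Ω') : ℝ :=
  limitZ E θ k ω / (limitZ E θ k₀ ω - limitZ E θ (m * k₀) ω)

/-- `g` is a (Borel, nonnegative) joint probability density of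
`(Z̃_∞(k_1), …, Z̃_∞(k_L))` at the parameter `θ = (ξ, p)`. -/
def IsLimitDensity [MeasurableSpace Ω'] (P' : Measure Ω') (E : ℕ → Ω' → ℝ) (k₀ m : ℝ) {L : ℕ}
    (k : Fin L → ℝ) (θ : ℝ × ℝ) (g : (Fin L → ℝ) → ℝ) : Prop :=
  Measurable g ∧ (∀ z, 0 ≤ g z) ∧
    P'.map (fun ω l => limitZTilde E k₀ m θ (k l) ω) =
      volume.withDensity (fun z => ENNReal.ofReal (g z))

end Limit

/-- The average posterior risk of the decision `q`: the approximate likelihood is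
`q' ↦ g (a (qv_1 - q'), …, a (qv_L - q'))`, the prior is `π` with support `U = {π ≠ 0}`, and the
loss is `u ↦ ρ (a u)`. It takes values in `[0, ∞]`. -/
def posteriorRisk (ρ prior : ℝ → ℝ) {L : ℕ} (g : (Fin L → ℝ) → ℝ) (a : ℝ) (qv : Fin L → ℝ)
    (q : ℝ) : ℝ≥0∞ :=
  ∫⁻ t in Function.support prior, ENNReal.ofReal (ρ (a * (q - t))) *
    (ENNReal.ofReal (g (fun l => a * (qv l - t)) * prior t) /
      ∫⁻ s in Function.support prior, ENNReal.ofReal (g (fun l => a * (qv l - s)) * prior s))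

/-- The limiting posterior risk
`Q_∞(z, w) = ∫ ρ(z - v) g(w - v) / (∫ g(w - v') dv') dv`, with values in `[0, ∞]`. -/
def limitRisk (ρ : ℝ → ℝ) {L : ℕ} (g : (Fin L → ℝ) → ℝ) (w : Fin L → ℝ) (z : ℝ) : ℝ≥0∞ :=
  ∫⁻ v, ENNReal.ofReal (ρ (z - v)) *
    (ENNReal.ofReal (g (fun l => w l - v)) / ∫⁻ s, ENNReal.ofReal (g (fun l => w l - s)))

end Frontier

end

/-!
The argument has three layers.

*Extreme value theory.* The extreme sample quantiles are, with probability tending to one, fixed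
order statistics: if `n_x` observations have input at most `x`, the first-order conditions of the
quantile objective place `qhat (1 - κ / n)` at the order statistic of rank `⌈κ n_x / n⌉` from the
top, and `n_x / n` tends to `p₀` while `κ p₀` is not an integer
(`tendsto_measure_qhat_ne_kthLargest`). The observations with larger inputs are given the output
`-1`, below all feasible outputs, so that only one i.i.d. sample of reals remains. It has
the law of the image of a uniform sample under its tail quantile function, whose behaviour at `0` is
the inverse of the regular variation of the tail at `q(1)` (`tendsto_tailQuantile_ratio`). The density of the smallest
uniform order statistics, rescaled by `n`, converges pointwise to the density of the partial sums of
standard exponential variables, and Fatou's lemma with the portmanteau theorem turns this into joint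
convergence in distribution of the top order statistics (`tendstoInDistribution_kthLargest`).

*Deterministic convergence of minimizers.* In the coordinate `v = α (q - q(1))` the scale enters the
posterior risk only through the prior, which is continuous and positive at `q(1)`. Hence the risk
converges pointwise to the limiting risk along convergent statistics, by dominated convergence
(`tendsto_posteriorRisk`). The risk is convex in the decision, so on the line pointwise convergence
to a function with a unique minimizer forces convergence of minimizers
(`tendsto_of_isMin_of_segment`).

*Transfer.* A continuous mapping theorem for relations (`tendstoInDistribution_of_relation`) applies
the deterministic statement to the statistics, without a measurable selection of minimizers. The
denominator of the limiting risk is almost surely positive because the limit of the statistics has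
the continuous density `f (ξ₀, p₀)` (`ae_lintegral_translate_ne_zero`).
-/

namespace Frontier

/-! ### Order statistics and sample quantiles -/

/-- The `j`-th largest of the numbers `y 0, …, y (n - 1)`, counted from `j = 0` and with
multiplicity: the largest value of the minimum of `y` over `j + 1` distinct indices. It is
meaningful for `j < n`. This max-min form makes measurability in `y` immediate. -/
noncomputable def kthLargest {n : ℕ} (y : Fin n → ℝ) (j : ℕ) : ℝ :=
  ⨆ σ : Fin (j + 1) ↪ Fin n, ⨅ a, y (σ a)

lemma measurable_kthLargest (n j : ℕ) : Measurable fun y : Fin n → ℝ => kthLargest y j :=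
  Measurable.iSup fun σ => Measurable.iInf fun a => measurable_pi_apply (σ a)

lemma kthLargest_eq {n : ℕ} (y : Fin n → ℝ) (j : ℕ) (c : ℝ)
    (h₁ : (Finset.univ.filter fun i => c < y i).card ≤ j)
    (h₂ : j < (Finset.univ.filter fun i => c ≤ y i).card) : kthLargest y j = c := by
  classical
  obtain ⟨τ, hτ⟩ : ∃ τ : Fin (j + 1) ↪ Fin n, ∀ a, c ≤ y (τ a) := by
    exact ⟨(Finset.orderEmbOfCardLe _ h₂).toEmbedding, fun a =>
      (Finset.mem_filter.1 (Finset.orderEmbOfCardLe_mem _ h₂ a)).2⟩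
  have : Nonempty (Fin (j + 1) ↪ Fin n) := ⟨τ⟩
  refine le_antisymm (ciSup_le fun σ => ?_) ?_
  · by_contra! hlt
    have hsub : Finset.univ.map σ ⊆ Finset.univ.filter fun i => c < y i := by
      intro i hi
      obtain ⟨a, -, rfl⟩ := Finset.mem_map.1 hi
      exact Finset.mem_filter.2 ⟨Finset.mem_univ _,
        hlt.trans_le (ciInf_le (Set.finite_range _).bddBelow a)⟩
    have := (Finset.card_le_card hsub).trans h₁
    rw [Finset.card_map, Finset.card_univ, Fintype.card_fin] at this
    omega
  · exact (le_ciInf hτ).trans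
      (le_ciSup (f := fun σ : Fin (j + 1) ↪ Fin n => ⨅ a, y (σ a)) (Set.finite_range _).bddAbove τ)

/-- If `σ` lists the indices of the smallest entries of `u` in increasing order, then an antitone
image of `u` has its largest entries along `σ`. -/
lemma kthLargest_antitone_comp {n J : ℕ} (Q : ℝ → ℝ) (hQ : AntitoneOn Q (Set.Ioo 0 1))
    (u : Fin n → ℝ) (hu : ∀ i, u i ∈ Set.Ioo (0 : ℝ) 1)
    (σ : Fin J ↪ Fin n) (hσ : StrictMono (u ∘ σ))
    (hout : ∀ i, i ∉ Set.range σ → ∀ a, u (σ a) < u i) (j : Fin J) :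
    kthLargest (fun i => Q (u i)) j = Q (u (σ j)) := by
  classical
  refine kthLargest_eq _ _ _ ?_ ?_
  · have hsub : (Finset.univ.filter fun i => Q (u (σ j)) < Q (u i)) ⊆
        (Finset.univ.filter fun a : Fin J => a < j).map σ := by
      intro i hi
      have hi' := (Finset.mem_filter.1 hi).2
      have hlt : u i < u (σ j) := by
        by_contra! h
        exact absurd (hQ (hu _) (hu _) h) (not_le.2 hi')
      have hmem : i ∈ Set.range σ := by
        by_contra h
        exact absurd (hout i h j) (not_lt.2 hlt.le)
      obtain ⟨a, rfl⟩ := hmem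
      exact Finset.mem_map.2 ⟨a, Finset.mem_filter.2 ⟨Finset.mem_univ _, hσ.lt_iff_lt.1 hlt⟩, rfl⟩
    refine (Finset.card_le_card hsub).trans ?_
    rw [Finset.card_map, show (Finset.univ.filter fun a : Fin J => a < j) = Finset.Iio j by
      ext a; simp, Fin.card_Iio]
  · have hsub : (Finset.univ.filter fun a : Fin J => a ≤ j).map σ ⊆
        (Finset.univ.filter fun i => Q (u (σ j)) ≤ Q (u i)) := by
      intro i hi
      obtain ⟨a, ha, rfl⟩ := Finset.mem_map.1 hi
      exact Finset.mem_filter.2 ⟨Finset.mem_univ _,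
        hQ (hu _) (hu _) (hσ.monotone (Finset.mem_filter.1 ha).2)⟩
    refine lt_of_lt_of_le ?_ (Finset.card_le_card hsub)
    rw [Finset.card_map, show (Finset.univ.filter fun a : Fin J => a ≤ j) = Finset.Iic j by
      ext a; simp, Fin.card_Iic]
    exact Nat.lt_succ_self _

lemma checkFun_of_nonpos {τ u : ℝ} (hu : u ≤ 0) : checkFun τ u = (τ - 1) * u := by
  simp [checkFun, Set.indicator, hu]

lemma checkFun_of_nonneg {τ u : ℝ} (hu : 0 ≤ u) : checkFun τ u = τ * u := by
  rcases hu.eq_or_lt with rfl | hu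
  · simp [checkFun]
  · simp [checkFun, Set.indicator, not_le.2 hu]

/-- First-order conditions: a `τ`-quantile has at most `τ N` points strictly to its left and at
least `τ N` points weakly to its left. -/
lemma card_of_isMinOn_checkFun {ι : Type*} (s : Finset ι) (y : ι → ℝ) (τ q : ℝ)
    (hq : ∀ q', ∑ i ∈ s, checkFun τ (y i - q) ≤ ∑ i ∈ s, checkFun τ (y i - q')) :
    τ * s.card ≤ (s.filter fun i => y i ≤ q).card ∧
      ((s.filter fun i => y i < q).card : ℝ) ≤ τ * s.card := by
  constructor
  · have hev : ∀ᶠ δ in 𝓝[>] (0 : ℝ), ∀ i ∈ s, q < y i → q + δ ≤ y i := by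
      rw [eventually_all_finset]
      intro i _
      by_cases hi : q < y i
      · filter_upwards [Ioo_mem_nhdsGT (sub_pos.2 hi)] with δ hδ _
        linarith [hδ.2]
      · exact .of_forall fun δ h => absurd h hi
    obtain ⟨δ, hδ, hδ0⟩ := (hev.and self_mem_nhdsWithin).exists
    have hδ0 : 0 < δ := hδ0
    have hsum : ∑ i ∈ s, checkFun τ (y i - (q + δ)) - ∑ i ∈ s, checkFun τ (y i - q) =
        ∑ i ∈ s, δ * ((if y i ≤ q then 1 else 0) - τ) := by
      rw [← Finset.sum_sub_distrib]
      refine Finset.sum_congr rfl fun i hi => ?_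
      by_cases h : y i ≤ q
      · rw [checkFun_of_nonpos (by linarith), checkFun_of_nonpos (by linarith), if_pos h]
        ring
      · have := hδ i hi (not_le.1 h)
        rw [checkFun_of_nonneg (by linarith), checkFun_of_nonneg (by linarith), if_neg h]
        ring
    rw [← Finset.mul_sum, Finset.sum_sub_distrib, Finset.sum_boole, Finset.sum_const,
      nsmul_eq_mul] at hsum
    have h0 : 0 ≤ δ * (((s.filter fun i => y i ≤ q).card : ℝ) - s.card * τ) := by
      linarith [hq (q + δ)]
    have := nonneg_of_mul_nonneg_right h0 hδ0
    linarith
  · have hev : ∀ᶠ δ in 𝓝[>] (0 : ℝ), ∀ i ∈ s, y i < q → y i ≤ q - δ := by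
      rw [eventually_all_finset]
      intro i _
      by_cases hi : y i < q
      · filter_upwards [Ioo_mem_nhdsGT (sub_pos.2 hi)] with δ hδ _
        linarith [hδ.2]
      · exact .of_forall fun δ h => absurd h hi
    obtain ⟨δ, hδ, hδ0⟩ := (hev.and self_mem_nhdsWithin).exists
    have hδ0 : 0 < δ := hδ0
    have hsum : ∑ i ∈ s, checkFun τ (y i - (q - δ)) - ∑ i ∈ s, checkFun τ (y i - q) =
        ∑ i ∈ s, δ * (τ - (if y i < q then 1 else 0)) := by
      rw [← Finset.sum_sub_distrib]
      refine Finset.sum_congr rfl fun i hi => ?_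
      by_cases h : y i < q
      · have := hδ i hi h
        rw [checkFun_of_nonpos (by linarith), checkFun_of_nonpos (by linarith), if_pos h]
        ring
      · rw [checkFun_of_nonneg (by linarith), checkFun_of_nonneg (by linarith), if_neg h]
        ring
    rw [← Finset.mul_sum, Finset.sum_sub_distrib, Finset.sum_boole, Finset.sum_const,
      nsmul_eq_mul] at hsum
    have h0 : 0 ≤ δ * (s.card * τ - ((s.filter fun i => y i < q).card : ℝ)) := by
      linarith [hq (q - δ)]
    have := nonneg_of_mul_nonneg_right h0 hδ0
    linarith

/-- A sample quantile at level `1 - κ / n` over the subsample `A` is an order statistic of the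
whole sample, once the outputs outside `A` are replaced by a value below the range of `y`. -/
lemma kthLargest_eq_of_isMinOn {n : ℕ} (A : Fin n → Prop) [DecidablePred A] (y : Fin n → ℝ)
    (hy : ∀ i, A i → 0 ≤ y i) (κ q : ℝ) (hn : κ < n) (j : ℕ)
    (hq : ∀ q', ∑ i ∈ Finset.univ.filter A, checkFun (1 - κ / n) (y i - q) ≤
      ∑ i ∈ Finset.univ.filter A, checkFun (1 - κ / n) (y i - q'))
    (hlo : (j : ℝ) < κ * ((Finset.univ.filter A).card / n))
    (hhi : κ * ((Finset.univ.filter A).card / n) < j + 1) :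
    q = kthLargest (fun i => if A i then y i else -1) j := by
  obtain ⟨h1, h2⟩ := card_of_isMinOn_checkFun _ y _ q hq
  set N := (Finset.univ.filter A).card with hN
  have hκN : κ * (N / n) = κ / n * N := by ring
  rw [hκN] at hlo hhi
  have hNpos : (0 : ℝ) < N := by
    rcases Nat.eq_zero_or_pos N with h | h
    · rw [h] at hlo
      have : (0 : ℝ) ≤ j := j.cast_nonneg
      simp at hlo
      linarith
    · exact_mod_cast h
  have hn0 : (0 : ℝ) < n := by
    have hle : N ≤ n := by simpa using Finset.card_le_univ (Finset.univ.filter A)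
    exact hNpos.trans_le (by exact_mod_cast hle)
  have hκ : 0 < 1 - κ / n := by
    rw [sub_pos, div_lt_one hn0]
    exact hn
  have hq0 : 0 ≤ q := by
    have hpos : 0 < (((Finset.univ.filter A).filter fun i => y i ≤ q).card : ℝ) :=
      (mul_pos hκ hNpos).trans_le h1
    obtain ⟨i, hi⟩ := Finset.card_pos.1 (by exact_mod_cast hpos)
    have hi' := Finset.mem_filter.1 hi
    exact (hy i (Finset.mem_filter.1 hi'.1).2).trans hi'.2
  have c1 : ((Finset.univ.filter A).filter fun i => y i ≤ q).card +
      (Finset.univ.filter fun i => q < if A i then y i else -1).card = N := by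
    rw [hN, ← Finset.card_filter_add_card_filter_not (s := Finset.univ.filter A)
      (fun i => y i ≤ q)]
    congr 2
    ext i
    by_cases hA : A i <;> simp [hA]
    linarith
  have c2 : ((Finset.univ.filter A).filter fun i => y i < q).card +
      (Finset.univ.filter fun i => q ≤ if A i then y i else -1).card = N := by
    rw [hN, ← Finset.card_filter_add_card_filter_not (s := Finset.univ.filter A)
      (fun i => y i < q)]
    congr 2
    ext i
    by_cases hA : A i <;> simp [hA]
    linarith
  symm
  refine kthLargest_eq _ _ _ ?_ ?_
  · have c1' := congrArg (Nat.cast (R := ℝ)) c1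
    push_cast at c1'
    have : ((Finset.univ.filter fun i => q < if A i then y i else -1).card : ℝ) < j + 1 := by
      linarith
    exact Nat.lt_succ_iff.1 (by exact_mod_cast this)
  · have c2' := congrArg (Nat.cast (R := ℝ)) c2
    push_cast at c2'
    have : (j : ℝ) < ((Finset.univ.filter fun i => q ≤ if A i then y i else -1).card : ℝ) := by
      linarith
    exact_mod_cast this

/-! ### The tail quantile function and its regular variation -/

/-- The quantile function of `ν` as a function of the upper tail probability `u ∈ (0, 1)`: the
smallest `y` with `ν (y, ∞) ≤ u`. -/
noncomputable def tailQuantile (ν : Measure ℝ) (u : ℝ) : ℝ :=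
  sInf {y | ν.real (Set.Ioi y) ≤ u}

lemma measureReal_Ioi_eq_one_sub_cdf (ν : Measure ℝ) [IsProbabilityMeasure ν] (y : ℝ) :
    ν.real (Set.Ioi y) = 1 - cdf ν y := by
  rw [cdf_eq_real, ← Set.compl_Iic, probReal_compl_eq_one_sub measurableSet_Iic]

lemma antitone_measureReal_Ioi (ν : Measure ℝ) [IsProbabilityMeasure ν] :
    Antitone fun y => ν.real (Set.Ioi y) :=
  fun _ _ h => measureReal_mono (Set.Ioi_subset_Ioi h)

/-- The Galois connection between the tail and the tail quantile function. -/
lemma tailQuantile_le_iff (ν : Measure ℝ) [IsProbabilityMeasure ν] {u : ℝ}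
    (hu : u ∈ Set.Ioo (0 : ℝ) 1) (y : ℝ) :
    tailQuantile ν u ≤ y ↔ ν.real (Set.Ioi y) ≤ u := by
  have hS : {y | ν.real (Set.Ioi y) ≤ u} = {y | 1 - u ≤ cdf ν y} := by
    ext y
    simp only [Set.mem_ofPred_eq, measureReal_Ioi_eq_one_sub_cdf]
    constructor <;> intro h <;> linarith
  have hne : {y | 1 - u ≤ cdf ν y}.Nonempty := by
    have := (tendsto_cdf_atTop ν).eventually (lt_mem_nhds (show 1 - u < 1 by linarith [hu.1]))
    obtain ⟨y, hy⟩ := this.exists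
    exact ⟨y, hy.le⟩
  have hbdd : BddBelow {y | 1 - u ≤ cdf ν y} := by
    have := (tendsto_cdf_atBot ν).eventually (gt_mem_nhds (show 0 < 1 - u by linarith [hu.2]))
    obtain ⟨b, hb⟩ := this.exists
    refine ⟨b, fun y hy => ?_⟩
    by_contra! h
    exact absurd (hy.trans (monotone_cdf ν h.le)) (not_le.2 hb)
  have hmem : 1 - u ≤ cdf ν (sInf {y | 1 - u ≤ cdf ν y}) := by
    have hc := ((cdf ν).right_continuous (sInf {y | 1 - u ≤ cdf ν y})).tendsto.mono_left
      (nhdsWithin_mono _ Set.Ioi_subset_Ici_self)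
    refine ge_of_tendsto hc ?_
    filter_upwards [self_mem_nhdsWithin] with y hy
    obtain ⟨s, hs, hsy⟩ := exists_lt_of_csInf_lt hne hy
    exact hs.trans (monotone_cdf ν hsy.le)
  have hiff : ν.real (Set.Ioi y) ≤ u ↔ y ∈ {y | 1 - u ≤ cdf ν y} := by
    rw [← hS]
    rfl
  rw [hiff, tailQuantile, hS]
  exact ⟨fun h => le_trans hmem (monotone_cdf ν h), fun h => csInf_le hbdd h⟩

lemma antitoneOn_tailQuantile (ν : Measure ℝ) [IsProbabilityMeasure ν] :
    AntitoneOn (tailQuantile ν) (Set.Ioo 0 1) := fun _ ha _ hb hab =>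
  (tailQuantile_le_iff ν hb _).2 (((tailQuantile_le_iff ν ha _).1 le_rfl).trans hab)

lemma measurable_tailQuantile (ν : Measure ℝ) [IsProbabilityMeasure ν] :
    Measurable (tailQuantile ν) := by
  refine measurable_of_Iic fun y => ?_
  -- Outside `[0, 1)` the infimum is over `∅` or the whole line, so the junk value `0` appears.
  have hout : ∀ u, u ∉ Set.Ioo (0 : ℝ) 1 → u ≠ 0 → tailQuantile ν u = 0 := by
    intro u hu hu0
    rcases lt_or_gt_of_ne hu0 with h | h
    · have : {y | ν.real (Set.Ioi y) ≤ u} = ∅ := by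
        ext y
        simpa using h.trans_le measureReal_nonneg
      rw [tailQuantile, this, Real.sInf_empty]
    · have h1 : 1 ≤ u := not_lt.1 fun h1 => hu ⟨h, h1⟩
      have : {y | ν.real (Set.Ioi y) ≤ u} = Set.univ := by
        ext y
        simpa using measureReal_le_one.trans h1
      rw [tailQuantile, this, Real.sInf_univ]
  have hset : tailQuantile ν ⁻¹' Set.Iic y =
      (Set.Ioo 0 1 ∩ Set.Ici (ν.real (Set.Ioi y))) ∪ ({0} ∩ tailQuantile ν ⁻¹' Set.Iic y) ∪
        ((Set.Ioo 0 1 ∪ {0})ᶜ ∩ {_u | 0 ≤ y}) := by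
    ext u
    by_cases hu : u ∈ Set.Ioo (0 : ℝ) 1
    · have hu0 : u ≠ 0 := hu.1.ne'
      simpa [hu, hu0, hu.1, hu.2, hu.1.not_gt] using tailQuantile_le_iff ν hu y
    · by_cases hu0 : u = 0
      · subst hu0
        simp
      · have h1 : 0 < u → 1 ≤ u := fun h0 => not_lt.1 fun h1 => hu ⟨h0, h1⟩
        have h2 : 0 ≤ u → 1 ≤ u := fun h0 => h1 (h0.lt_of_ne' hu0)
        simpa [hu0, hu, hout u hu hu0] using fun _ => h2
  rw [hset]
  exact ((measurableSet_Ioo.inter measurableSet_Ici).union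
    (Set.subsingleton_singleton.anti Set.inter_subset_left).measurableSet).union
    ((measurableSet_Ioo.union (measurableSet_singleton 0)).compl.inter (MeasurableSet.const _))

instance isProbabilityMeasure_restrict_Ioo_zero_one :
    IsProbabilityMeasure ((volume : Measure ℝ).restrict (Set.Ioo 0 1)) :=
  ⟨by simp⟩

/-- Every law on the line is the image of the uniform law under its tail quantile function. -/
lemma map_tailQuantile (ν : Measure ℝ) [IsProbabilityMeasure ν] :
    (volume.restrict (Set.Ioo 0 1)).map (tailQuantile ν) = ν := by
  have := Measure.isProbabilityMeasure_map
    (μ := (volume : Measure ℝ).restrict (Set.Ioo 0 1)) (measurable_tailQuantile ν).aemeasurable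
  refine Measure.ext_of_Iic _ _ fun y => ?_
  rw [Measure.map_apply (measurable_tailQuantile ν) measurableSet_Iic,
    Measure.restrict_apply' measurableSet_Ioo]
  have hset : tailQuantile ν ⁻¹' Set.Iic y ∩ Set.Ioo 0 1 =
      Set.Ici (ν.real (Set.Ioi y)) ∩ Set.Ioo 0 1 := by
    ext u
    simp only [Set.mem_inter_iff, Set.mem_preimage, Set.mem_Iic, Set.mem_Ici]
    exact and_congr_left fun hu => tailQuantile_le_iff ν hu y
  have hae : (Set.Ici (ν.real (Set.Ioi y)) ∩ Set.Ioo 0 1 : Set ℝ) =ᵐ[volume]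
      Set.Ico (ν.real (Set.Ioi y)) 1 := by
    have h0 : ∀ᵐ u : ℝ, u ≠ 0 := by simp [ae_iff]
    filter_upwards [h0] with u hu
    refine propext ⟨fun h => ⟨h.1, h.2.2⟩, fun h => ⟨h.1, ?_, h.2⟩⟩
    exact lt_of_le_of_ne (measureReal_nonneg.trans h.1) hu.symm
  rw [hset, measure_congr hae, Real.volume_Ico, measureReal_Ioi_eq_one_sub_cdf, cdf_eq_real,
    sub_sub_cancel, ofReal_measureReal]

section RegularVariation

variable (ν : Measure ℝ) [IsProbabilityMeasure ν] {q₁ κ : ℝ}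

/-- A regularly varying tail with positive exponent has no atom at the endpoint: otherwise the
ratio of tails would tend to `1`. -/
lemma tendsto_tail_zero (hκ : 0 < κ)
    (hRV : ∀ v : ℝ, 0 < v → Tendsto (fun z : ℝ => ν.real (Set.Ioi (q₁ - v * z)) /
      ν.real (Set.Ioi (q₁ - z))) (𝓝[>] 0) (𝓝 (v ^ κ))) :
    Tendsto (fun z => ν.real (Set.Ioi (q₁ - z))) (𝓝[>] 0) (𝓝 0) := by
  have hmono : Monotone fun z => ν.real (Set.Ioi (q₁ - z)) := fun a b h =>
    antitone_measureReal_Ioi ν (by linarith)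
  obtain ⟨c, hc⟩ : ∃ c, Tendsto (fun z => ν.real (Set.Ioi (q₁ - z))) (𝓝[>] 0) (𝓝 c) :=
    ⟨_, hmono.tendsto_nhdsGT 0⟩
  by_cases h0 : c = 0
  · rwa [h0] at hc
  · exfalso
    have h2 : Tendsto (fun z : ℝ => 2 * z) (𝓝[>] 0) (𝓝[>] 0) := by
      refine tendsto_nhdsWithin_iff.2 ⟨?_, ?_⟩
      · exact ((continuous_const_mul (2 : ℝ)).tendsto' 0 0 (by simp)).mono_left nhdsWithin_le_nhds
      · filter_upwards [self_mem_nhdsWithin] with z hz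
        exact Set.mem_Ioi.2 (mul_pos two_pos (Set.mem_Ioi.1 hz))
    have hlim := (hc.comp h2).div hc h0
    rw [div_self h0] at hlim
    have := tendsto_nhds_unique hlim (hRV 2 two_pos)
    exact absurd this (Real.one_lt_rpow one_lt_two hκ).ne

lemma eventually_tailQuantile_lt (hκ : 0 < κ)
    (hRV : ∀ v : ℝ, 0 < v → Tendsto (fun z : ℝ => ν.real (Set.Ioi (q₁ - v * z)) /
      ν.real (Set.Ioi (q₁ - z))) (𝓝[>] 0) (𝓝 (v ^ κ))) :
    ∀ᶠ s in 𝓝[>] (0 : ℝ), 0 < q₁ - tailQuantile ν s := by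
  filter_upwards [Ioo_mem_nhdsGT (zero_lt_one' ℝ)] with s hs
  have h := ((tendsto_tail_zero ν hκ hRV).eventually (gt_mem_nhds hs.1)).and self_mem_nhdsWithin
  obtain ⟨z, hz, hz0⟩ := h.exists
  have hz0 : 0 < z := hz0
  have := (tailQuantile_le_iff ν hs _).2 hz.le
  linarith

lemma tendsto_sub_tailQuantile (hκ : 0 < κ) (hpos : ∀ y < q₁, 0 < ν.real (Set.Ioi y))
    (hRV : ∀ v : ℝ, 0 < v → Tendsto (fun z : ℝ => ν.real (Set.Ioi (q₁ - v * z)) /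
      ν.real (Set.Ioi (q₁ - z))) (𝓝[>] 0) (𝓝 (v ^ κ))) :
    Tendsto (fun s => q₁ - tailQuantile ν s) (𝓝[>] 0) (𝓝[>] 0) := by
  refine tendsto_nhdsWithin_iff.2 ⟨tendsto_order.2 ⟨fun a ha => ?_, fun a ha => ?_⟩,
    eventually_tailQuantile_lt ν hκ hRV⟩
  · filter_upwards [eventually_tailQuantile_lt ν hκ hRV] with s hs
    linarith
  · filter_upwards [Ioo_mem_nhdsGT (zero_lt_one' ℝ),
      Ioo_mem_nhdsGT (hpos (q₁ - a) (by linarith))] with s hs hs'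
    have := (tailQuantile_le_iff ν hs (q₁ - a)).not.2 (not_le.2 hs'.2)
    linarith

/-- Inversion of regular variation: if the tail of `ν` at the endpoint `q₁` is regularly varying
with exponent `κ`, then the distance of the tail quantile function from `q₁` is regularly varying
at `0` with exponent `1 / κ`. -/
lemma tendsto_tailQuantile_ratio (hκ : 0 < κ) (hpos : ∀ y < q₁, 0 < ν.real (Set.Ioi y))
    (hRV : ∀ v : ℝ, 0 < v → Tendsto (fun z : ℝ => ν.real (Set.Ioi (q₁ - v * z)) /
      ν.real (Set.Ioi (q₁ - z))) (𝓝[>] 0) (𝓝 (v ^ κ))) {u : ℝ} (hu : 0 < u) :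
    Tendsto (fun s => (tailQuantile ν (u * s) - q₁) / (q₁ - tailQuantile ν s)) (𝓝[>] 0)
      (𝓝 (-(u ^ κ⁻¹))) := by
  have hz := tendsto_sub_tailQuantile ν hκ hpos hRV
  have hφ : 0 < u ^ κ⁻¹ := Real.rpow_pos_of_pos hu _
  have hφκ : (u ^ κ⁻¹) ^ κ = u := Real.rpow_inv_rpow hu.le hκ.ne'
  have hs1 : ∀ᶠ s in 𝓝[>] (0 : ℝ), s ∈ Set.Ioo (0 : ℝ) 1 ∧ u * s ∈ Set.Ioo (0 : ℝ) 1 := by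
    filter_upwards [Ioo_mem_nhdsGT (zero_lt_one' ℝ), Ioo_mem_nhdsGT (inv_pos.2 hu)] with s hs hs'
    refine ⟨hs, mul_pos hu hs.1, ?_⟩
    calc u * s < u * u⁻¹ := by gcongr; exact hs'.2
      _ = 1 := mul_inv_cancel₀ hu.ne'
  refine tendsto_order.2 ⟨fun a ha => ?_, fun a ha => ?_⟩
  · obtain ⟨v', hv', hv'a⟩ := exists_between (show u ^ κ⁻¹ < -a by linarith)
    have hv'0 : 0 < v' := hφ.trans hv'
    -- The point `q₁ - w * z` with `w = -a / v' > 1` lies strictly below the `s`-quantile.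
    have hw : 1 < -a / v' := by rwa [one_lt_div hv'0]
    have hw0 : 0 < -a / v' := one_pos.trans hw
    have hwz : Tendsto (fun s => -a / v' * (q₁ - tailQuantile ν s)) (𝓝[>] 0) (𝓝[>] 0) := by
      refine tendsto_nhdsWithin_iff.2 ⟨?_, ?_⟩
      · simpa using (hz.mono_right nhdsWithin_le_nhds).const_mul (-a / v')
      · filter_upwards [eventually_tailQuantile_lt ν hκ hRV] with s hs
        exact mul_pos hw0 hs
    have hlt : u < v' ^ κ := by
      rw [← hφκ]
      exact Real.rpow_lt_rpow hφ.le hv' hκ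
    filter_upwards [hs1, eventually_tailQuantile_lt ν hκ hRV,
      ((hRV v' hv'0).comp hwz).eventually (lt_mem_nhds hlt)] with s hs hzs hr
    have hbelow : s < ν.real (Set.Ioi (q₁ - -a / v' * (q₁ - tailQuantile ν s))) := by
      refine not_le.1 ((tailQuantile_le_iff ν hs.1 _).not.1 ?_)
      nlinarith
    have hr' := (lt_div_iff₀ (hs.1.1.trans hbelow)).1 hr
    have hcancel : v' * (-a / v' * (q₁ - tailQuantile ν s)) = -a * (q₁ - tailQuantile ν s) := by
      field_simp
    rw [hcancel] at hr'
    have hfin : u * s < ν.real (Set.Ioi (q₁ - -a * (q₁ - tailQuantile ν s))) :=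
      (mul_lt_mul_of_pos_left hbelow hu).trans hr'
    have := not_le.1 ((tailQuantile_le_iff ν hs.2 _).not.2 (not_le.2 hfin))
    rw [lt_div_iff₀ hzs]
    linarith
  · obtain ⟨v, hva, hv⟩ := exists_between (show max (-a) 0 < u ^ κ⁻¹ from
      max_lt (by linarith) hφ)
    have hv0 : 0 < v := (le_max_right _ _).trans_lt hva
    have hva' : -a < v := (le_max_left _ _).trans_lt hva
    have hlt : v ^ κ < u := by
      rw [← hφκ]
      exact Real.rpow_lt_rpow hv0.le hv hκ
    filter_upwards [hs1, eventually_tailQuantile_lt ν hκ hRV,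
      ((hRV v hv0).comp hz).eventually (gt_mem_nhds hlt)] with s hs hzs hr
    have hle : ν.real (Set.Ioi (q₁ - (q₁ - tailQuantile ν s))) ≤ s := by
      rw [sub_sub_cancel]
      exact (tailQuantile_le_iff ν hs.1 _).1 le_rfl
    have hpos' : 0 < ν.real (Set.Ioi (q₁ - (q₁ - tailQuantile ν s))) := hpos _ (by linarith)
    have hr' := (div_lt_iff₀ hpos').1 hr
    have hfin : ν.real (Set.Ioi (q₁ - v * (q₁ - tailQuantile ν s))) ≤ u * s :=
      hr'.le.trans (mul_le_mul_of_nonneg_left hle hu.le)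
    have := (tailQuantile_le_iff ν hs.2 _).2 hfin
    rw [div_lt_iff₀ hzs]
    nlinarith

end RegularVariation

/-! ### The joint density of the partial sums of standard exponential variables -/

lemma lintegral_fin_prod_eq_prod {n : ℕ} (μ : Fin n → Measure ℝ) [∀ i, SigmaFinite (μ i)]
    (f : Fin n → ℝ → ℝ≥0∞) (hf : ∀ i, Measurable (f i)) :
    ∫⁻ x, ∏ i, f i (x i) ∂(Measure.pi μ) = ∏ i, ∫⁻ x, f i x ∂(μ i) := by
  induction n with
  | zero => simp
  | succ n ih =>
    have hm' : Measurable fun x : Fin (n + 1) → ℝ => ∏ i, f i (x i) :=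
      Finset.measurable_prod _ fun i _ => (hf i).comp (measurable_pi_apply i)
    rw [← ((measurePreserving_piFinSuccAbove μ 0).symm).lintegral_comp hm']
    simp_rw [MeasurableEquiv.piFinSuccAbove_symm_apply, Fin.insertNthEquiv,
      Fin.prod_univ_succ, Fin.insertNth_zero, Equiv.coe_fn_mk, Fin.cons_succ, Fin.cons_zero]
    have hm : Measurable fun x : Fin n → ℝ => ∏ i : Fin n, f i.succ (x i) :=
      Finset.measurable_prod _ fun i _ => (hf i.succ).comp (measurable_pi_apply i)
    rw [← ih (fun i => μ i.succ) (fun i => f i.succ) fun i => hf _]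
    exact lintegral_prod_mul (hf 0).aemeasurable hm.aemeasurable

lemma pi_withDensity_fin {n : ℕ} (f : ℝ → ℝ≥0∞) (hf : Measurable f)
    [SigmaFinite ((volume : Measure ℝ).withDensity f)] :
    Measure.pi (fun _ : Fin n => (volume : Measure ℝ).withDensity f) =
      volume.withDensity fun x : Fin n → ℝ => ∏ i, f (x i) := by
  refine Measure.pi_eq fun s hs => ?_
  rw [withDensity_apply _ (MeasurableSet.univ_pi hs), volume_pi, Measure.restrict_pi_pi,
    lintegral_fin_prod_eq_prod _ (fun _ => f) fun _ => hf]
  exact Finset.prod_congr rfl fun i _ => (withDensity_apply _ (hs i)).symm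

/-- The density of the standard exponential law, with the value `0` at the origin. -/
noncomputable def expDensity (x : ℝ) : ℝ≥0∞ :=
  if 0 < x then ENNReal.ofReal (Real.exp (-x)) else 0

lemma measurable_expDensity : Measurable expDensity :=
  Measurable.ite measurableSet_Ioi (by fun_prop) measurable_const

lemma expMeasure_one_eq : expMeasure 1 = volume.withDensity expDensity := by
  refine withDensity_congr_ae ?_
  have h0 : ∀ᵐ u : ℝ, u ≠ 0 := by simp [ae_iff]
  filter_upwards [h0] with x hx
  change exponentialPDF 1 x = _
  rcases lt_or_gt_of_ne hx with h | h
  · rw [exponentialPDF_of_neg h, expDensity, if_neg (not_lt.2 h.le)]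
  · rw [exponentialPDF_of_nonneg h.le, expDensity, if_pos h]
    simp

/-- The summation matrix: `partialSumMatrix J *ᵥ x` lists the partial sums of `x`. -/
def partialSumMatrix (J : ℕ) : Matrix (Fin (J + 1)) (Fin (J + 1)) ℝ :=
  Matrix.of fun i j => if j ≤ i then 1 else 0

lemma det_partialSumMatrix (J : ℕ) : (partialSumMatrix J).det = 1 := by
  rw [Matrix.det_of_isLowerTriangular]
  · simp [partialSumMatrix]
  · intro i j hij
    have : i < j := hij
    simp [partialSumMatrix, not_le.2 this]

lemma measurePreserving_partialSum (J : ℕ) :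
    MeasurePreserving (Matrix.toLin' (partialSumMatrix J)) volume volume := by
  refine ⟨(Matrix.toLin' (partialSumMatrix J)).continuous_of_finiteDimensional.measurable, ?_⟩
  rw [Real.map_matrix_volume_pi_eq_smul_volume_pi (by simp [det_partialSumMatrix])]
  simp [det_partialSumMatrix]

lemma partialSum_apply (J : ℕ) (x : ℕ → ℝ) (i : Fin (J + 1)) :
    Matrix.toLin' (partialSumMatrix J) (fun j => x j) i = ∑ l ∈ Finset.range (i + 1), x l := by
  rw [Matrix.toLin'_apply, Matrix.mulVec, dotProduct]
  simp only [partialSumMatrix, Matrix.of_apply, ite_mul, one_mul, zero_mul]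
  rw [← Finset.sum_filter]
  refine Finset.sum_bij (fun j _ => (j : ℕ)) ?_ ?_ ?_ ?_
  · intro j hj
    have := (Finset.mem_filter.1 hj).2
    exact Finset.mem_range.2 (Nat.lt_succ_of_le this)
  · intro a _ b _ h
    exact Fin.ext h
  · intro l hl
    have hl' := Finset.mem_range.1 hl
    refine ⟨⟨l, by omega⟩, Finset.mem_filter.2 ⟨Finset.mem_univ _, ?_⟩, rfl⟩
    exact Fin.mk_le_of_le_val (by omega)
  · intro _ _
    rfl

/-- The set of strictly increasing vectors with positive entries. -/
def increasingPos (J : ℕ) : Set (Fin (J + 1) → ℝ) := {u | 0 < u 0 ∧ StrictMono u}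

lemma measurableSet_increasingPos (J : ℕ) : MeasurableSet (increasingPos J) := by
  have : increasingPos J = {u | 0 < u 0} ∩ ⋂ i : Fin J, {u | u i.castSucc < u i.succ} := by
    ext u
    simp [increasingPos, Fin.strictMono_iff_lt_succ]
  rw [this]
  exact (measurableSet_lt measurable_const (measurable_pi_apply _)).inter
    (MeasurableSet.iInter fun i =>
      measurableSet_lt (measurable_pi_apply _) (measurable_pi_apply _))

/-- The joint density of the first `J + 1` partial sums of i.i.d. standard exponential
variables. -/
noncomputable def partialSumDensity (J : ℕ) (u : Fin (J + 1) → ℝ) : ℝ≥0∞ :=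
  (increasingPos J).indicator (fun u => ENNReal.ofReal (Real.exp (-u (Fin.last J)))) u

lemma partialSum_mem_increasingPos_iff (J : ℕ) (x : ℕ → ℝ) :
    (fun i : Fin (J + 1) => ∑ l ∈ Finset.range (i + 1), x l) ∈ increasingPos J ↔
      ∀ i : Fin (J + 1), 0 < x i := by
  simp only [increasingPos, Fin.strictMono_iff_lt_succ, Set.mem_ofPred_eq]
  constructor
  · rintro ⟨h0, h⟩ i
    refine Fin.cases ?_ (fun i => ?_) i
    · simpa using h0
    · have := h i
      rw [Fin.val_succ, Fin.val_castSucc, Finset.sum_range_succ _ ((i : ℕ) + 1)] at this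
      rw [Fin.val_succ]
      linarith
  · intro h
    refine ⟨by simpa using h 0, fun i => ?_⟩
    rw [Fin.val_castSucc, Fin.val_succ, Finset.sum_range_succ _ ((i : ℕ) + 1)]
    have := h i.succ
    rw [Fin.val_succ] at this
    linarith

lemma prod_expDensity (J : ℕ) (x : ℕ → ℝ) :
    ∏ i : Fin (J + 1), expDensity (x i) =
      partialSumDensity J (fun i => ∑ l ∈ Finset.range (i + 1), x l) := by
  by_cases h : ∀ i : Fin (J + 1), 0 < x i
  · rw [partialSumDensity, Set.indicator_of_mem ((partialSum_mem_increasingPos_iff J x).2 h)]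
    simp only [Fin.val_last]
    rw [← Finset.sum_neg_distrib, Real.exp_sum,
      ENNReal.ofReal_prod_of_nonneg fun _ _ => (Real.exp_pos _).le, ← Fin.prod_univ_eq_prod_range
        (fun i => ENNReal.ofReal (Real.exp (-x i)))]
    exact Finset.prod_congr rfl fun i _ => if_pos (h i)
  · rw [partialSumDensity,
      Set.indicator_of_notMem fun hm => h ((partialSum_mem_increasingPos_iff J x).1 hm)]
    push Not at h
    obtain ⟨i, hi⟩ := h
    exact Finset.prod_eq_zero (Finset.mem_univ i) (if_neg (not_lt.2 hi))

lemma measurable_partialSumDensity (J : ℕ) : Measurable (partialSumDensity J) :=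
  Measurable.indicator (by fun_prop) (measurableSet_increasingPos J)

section

variable {Ω' : Type*} [MeasurableSpace Ω'] {P' : Measure Ω'}
  {E : ℕ → Ω' → ℝ}

/-- The partial sums of i.i.d. standard exponential variables have density `partialSumDensity`: the
summation map has determinant one and carries the product of the exponential densities to it. -/
lemma lintegral_partialSum (hE_law : ∀ i, HasLaw (E i) (expMeasure 1) P')
    (hE_indep : iIndepFun E P') (J : ℕ) (h : (Fin (J + 1) → ℝ) → ℝ≥0∞) (hh : Measurable h) :
    ∫⁻ ω, h (fun j => ∑ i ∈ Finset.range (j + 1), E i ω) ∂P' =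
      ∫⁻ u, partialSumDensity J u * h u := by
  have hlaw : HasLaw (fun ω (i : Fin (J + 1)) => E i ω)
      (Measure.pi fun _ : Fin (J + 1) => expMeasure 1) P' := by
    have := isProbabilityMeasure_expMeasure (zero_lt_one' ℝ)
    exact iIndepFun.hasLaw_pi (fun i : Fin (J + 1) => hE_law i)
      (hE_indep.precomp Fin.val_injective)
  have hS := measurePreserving_partialSum J
  have : IsProbabilityMeasure (volume.withDensity expDensity) := by
    rw [← expMeasure_one_eq]
    exact isProbabilityMeasure_expMeasure one_pos
  rw [expMeasure_one_eq, pi_withDensity_fin _ measurable_expDensity] at hlaw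
  have h1 : ∀ ω, h (fun j => ∑ i ∈ Finset.range (j + 1), E i ω) =
      (h ∘ Matrix.toLin' (partialSumMatrix J)) (fun i => E i ω) := by
    intro ω
    rw [Function.comp_apply]
    congr 1
    ext j
    exact (partialSum_apply J (fun i => E i ω) j).symm
  simp_rw [h1]
  have hprod : Measurable fun x : Fin (J + 1) → ℝ => ∏ i, expDensity (x i) :=
    Finset.measurable_prod _ fun i _ => measurable_expDensity.comp (measurable_pi_apply i)
  have hdens : Measurable fun u => partialSumDensity J u * h u :=
    (measurable_partialSumDensity J).mul hh
  rw [hlaw.lintegral_comp (hh.comp hS.measurable).aemeasurable,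
    lintegral_withDensity_eq_lintegral_mul _ hprod (hh.comp hS.measurable),
    ← hS.lintegral_comp hdens]
  refine lintegral_congr fun x => ?_
  simp only [Pi.mul_apply, Function.comp_apply]
  congr 1
  -- Extend the vector to a sequence, so that its partial sums are sums over initial segments.
  have hx : x = fun j : Fin (J + 1) =>
      (fun l : ℕ => if hl : l < J + 1 then x ⟨l, hl⟩ else 0) j := by
    ext j
    simp [j.2]
  rw [hx, prod_expDensity]
  congr 1
  ext i
  exact (partialSum_apply J _ i).symm

end

/-! ### The smallest order statistics of a uniform sample -/

/-- The event that `σ` lists the indices of the `J + 1` smallest entries of `u`, in increasing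
order of the entries and without ties. -/
def lowestAt {n J : ℕ} (σ : Fin (J + 1) ↪ Fin n) : Set (Fin n → ℝ) :=
  {u | StrictMono (u ∘ σ) ∧ ∀ i, i ∉ Set.range σ → ∀ a, u (σ a) < u i}

lemma measurableSet_lowestAt {n J : ℕ} (σ : Fin (J + 1) ↪ Fin n) :
    MeasurableSet (lowestAt σ) := by
  have : lowestAt σ = (⋂ i : Fin J, {u | u (σ i.castSucc) < u (σ i.succ)}) ∩
      ⋂ i : Fin n, ⋂ _ : i ∉ Set.range σ, ⋂ a, {u | u (σ a) < u i} := by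
    ext u
    simp [lowestAt, Fin.strictMono_iff_lt_succ]
  rw [this]
  refine (MeasurableSet.iInter fun i => ?_).inter (MeasurableSet.iInter fun i =>
    MeasurableSet.iInter fun _ => MeasurableSet.iInter fun a => ?_)
  · exact measurableSet_lt (measurable_pi_apply _) (measurable_pi_apply _)
  · exact measurableSet_lt (measurable_pi_apply _) (measurable_pi_apply _)

lemma range_subset_of_mem_lowestAt {n J : ℕ} {σ τ : Fin (J + 1) ↪ Fin n} {u : Fin n → ℝ}
    (hσ : u ∈ lowestAt σ) (hτ : u ∈ lowestAt τ) : Set.range σ ⊆ Set.range τ := by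
  classical
  by_contra hns
  obtain ⟨i, hi, hi'⟩ := Set.not_subset.1 hns
  have hcard : (Finset.univ.map σ).card = (Finset.univ.map τ).card := by
    rw [Finset.card_map, Finset.card_map]
  -- Both ranges have `J + 1` elements, so the second is not contained in the first either.
  have hns' : ¬ Finset.univ.map τ ⊆ Finset.univ.map σ := by
    intro hsub
    have heq := Finset.eq_of_subset_of_card_le hsub hcard.le
    apply hi'
    obtain ⟨a, rfl⟩ := hi
    have : σ a ∈ Finset.univ.map τ := by
      rw [heq]
      exact Finset.mem_map_of_mem _ (Finset.mem_univ a)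
    obtain ⟨b, -, hb⟩ := Finset.mem_map.1 this
    exact ⟨b, hb⟩
  obtain ⟨i', hmem, hnot⟩ := Finset.not_subset.1 hns'
  obtain ⟨b, -, rfl⟩ := Finset.mem_map.1 hmem
  obtain ⟨a, rfl⟩ := hi
  have hnot' : τ b ∉ Set.range σ := by
    rintro ⟨c, hc⟩
    exact hnot (Finset.mem_map.2 ⟨c, Finset.mem_univ _, hc⟩)
  exact lt_asymm (hσ.2 _ hnot' a) (hτ.2 _ hi' b)

/-- A vector without ties among its smallest entries determines the positions of these entries. -/
lemma pairwise_disjoint_lowestAt (n J : ℕ) :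
    Pairwise (Function.onFun Disjoint fun σ : Fin (J + 1) ↪ Fin n => lowestAt σ) := by
  intro σ τ hne
  refine Set.disjoint_left.2 fun u hσ hτ => hne ?_
  have hrange : Set.range σ = Set.range τ :=
    (range_subset_of_mem_lowestAt hσ hτ).antisymm (range_subset_of_mem_lowestAt hτ hσ)
  have hcomp : u ∘ σ = u ∘ τ := by
    rw [← hσ.1.range_inj hτ.1, Set.range_comp, Set.range_comp, hrange]
  ext1 a
  obtain ⟨b, hb⟩ : σ a ∈ Set.range τ := hrange ▸ Set.mem_range_self a
  have h1 : u (τ b) = u (τ a) := by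
    rw [hb]
    exact congrFun hcomp a
  rw [← hb, hτ.1.injective h1]

/-- The uniform law on the unit cube. -/
noncomputable def uniformCube (ι : Type*) [Fintype ι] : Measure (ι → ℝ) :=
  Measure.pi fun _ => (volume : Measure ℝ).restrict (Set.Ioo 0 1)

instance (ι : Type*) [Fintype ι] : IsProbabilityMeasure (uniformCube ι) := by
  unfold uniformCube
  infer_instance

lemma restrict_Ioo_zero_one_Ioi {t : ℝ} (ht : 0 ≤ t) :
    (volume : Measure ℝ).restrict (Set.Ioo 0 1) (Set.Ioi t) = ENNReal.ofReal (1 - t) := by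
  rw [Measure.restrict_apply measurableSet_Ioi, Set.Ioi_inter_Ioo, max_eq_left ht,
    Real.volume_Ioo]

/-- Given that `σ` lists the smallest entries and that they form the vector `a`, each of the
remaining entries exceeds the last entry of `a` independently. -/
lemma le_uniformCube_lowestAt {n J : ℕ} (hJ : J + 1 < n) (σ : Fin (J + 1) ↪ Fin n)
    (O : Set (Fin (J + 1) → ℝ)) (hO : MeasurableSet O) :
    ∫⁻ a, (increasingPos J ∩ O).indicator
        (fun a => ENNReal.ofReal (1 - a (Fin.last J)) ^ (n - (J + 1))) a ≤
      uniformCube (Fin n) (lowestAt σ ∩ {u | u ∘ σ ∈ O}) := by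
  classical
  set R := {i : Fin n // i ∉ Set.range σ}
  let e : Fin (J + 1) ⊕ R ≃ Fin n :=
    ((Equiv.ofInjective σ σ.injective).sumCongr (Equiv.refl _)).trans
      (Equiv.Set.sumCompl (Set.range σ))
  have hcard : Fintype.card R = n - (J + 1) := by
    have := Fintype.card_congr e
    rw [Fintype.card_sum, Fintype.card_fin, Fintype.card_fin] at this
    omega
  let Ψ : (Fin (J + 1) → ℝ) × (R → ℝ) ≃ᵐ (Fin n → ℝ) :=
    (MeasurableEquiv.sumPiEquivProdPi fun _ : Fin (J + 1) ⊕ R => ℝ).symm.trans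
      (MeasurableEquiv.piCongrLeft (fun _ : Fin n => ℝ) e)
  have hΨ : MeasurePreserving Ψ ((uniformCube (Fin (J + 1))).prod (uniformCube R))
      (uniformCube (Fin n)) :=
    (measurePreserving_piCongrLeft
      (fun _ : Fin n => (volume : Measure ℝ).restrict (Set.Ioo 0 1)) e).comp
      (measurePreserving_sumPiEquivProdPi_symm
        fun _ : Fin (J + 1) ⊕ R => (volume : Measure ℝ).restrict (Set.Ioo 0 1))
  have hΨl : ∀ p a, Ψ p (σ a) = p.1 a := fun p a =>
    Equiv.piCongrLeft_apply_apply (fun _ : Fin n => ℝ) e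
      ((Equiv.sumPiEquivProdPi fun _ : Fin (J + 1) ⊕ R => ℝ).symm p) (Sum.inl a)
  have hΨr : ∀ p (i : R), Ψ p i = p.2 i := fun p i =>
    Equiv.piCongrLeft_apply_apply (fun _ : Fin n => ℝ) e
      ((Equiv.sumPiEquivProdPi fun _ : Fin (J + 1) ⊕ R => ℝ).symm p) (Sum.inr i)
  have hmeas : MeasurableSet (lowestAt σ ∩ {u | u ∘ σ ∈ O}) :=
    (measurableSet_lowestAt σ).inter
      ((measurable_pi_lambda _ fun a => measurable_pi_apply (σ a)) hO)
  rw [← hΨ.measure_preimage_equiv, Measure.prod_apply (Ψ.measurable hmeas)]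
  have hcube : uniformCube (Fin (J + 1)) =
      volume.restrict (Set.univ.pi fun _ => Set.Ioo (0 : ℝ) 1) := by
    rw [uniformCube, volume_pi, Measure.restrict_pi_pi]
  rw [hcube, ← lintegral_indicator (MeasurableSet.univ_pi fun _ => measurableSet_Ioo)]
  refine lintegral_mono fun a => ?_
  by_cases haS : a ∈ increasingPos J ∩ O
  swap
  · rw [Set.indicator_of_notMem haS]
    exact zero_le
  rw [Set.indicator_of_mem haS]
  rcases le_or_gt 1 (a (Fin.last J)) with h1 | h1
  · rw [ENNReal.ofReal_of_nonpos (by linarith), zero_pow (by omega)]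
    exact zero_le
  have hpos : ∀ j, 0 < a j := fun j => haS.1.1.trans_le (haS.1.2.monotone (Fin.zero_le j))
  have hac : a ∈ Set.univ.pi fun _ : Fin (J + 1) => Set.Ioo (0 : ℝ) 1 := fun j _ =>
    ⟨hpos j, (haS.1.2.monotone (Fin.le_last j)).trans_lt h1⟩
  rw [Set.indicator_of_mem hac]
  have hsub : (Set.univ.pi fun _ : R => Set.Ioi (a (Fin.last J))) ⊆
      Prod.mk a ⁻¹' (Ψ ⁻¹' (lowestAt σ ∩ {u | u ∘ σ ∈ O})) := by
    intro b hb
    have hcomp : Ψ (a, b) ∘ σ = a := funext fun j => hΨl (a, b) j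
    refine ⟨⟨?_, fun i hi j => ?_⟩, ?_⟩
    · rw [hcomp]
      exact haS.1.2
    · have h2 := hΨr (a, b) ⟨i, hi⟩
      rw [hΨl, h2]
      exact (haS.1.2.monotone (Fin.le_last j)).trans_lt (hb ⟨i, hi⟩ (Set.mem_univ _))
    · change Ψ (a, b) ∘ σ ∈ O
      rw [hcomp]
      exact haS.2
  refine le_trans (le_of_eq ?_) (measure_mono hsub)
  rw [uniformCube, Measure.pi_pi, Finset.prod_const, Finset.card_univ, hcard,
    restrict_Ioo_zero_one_Ioi (hpos _).le]

/-- A lower bound for the law of the `J + 1` smallest order statistics of a uniform sample, by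
summation over the possible positions of these order statistics. -/
lemma descFactorial_mul_lintegral_le {n J : ℕ} (hJ : J + 1 < n)
    (O : Set (Fin (J + 1) → ℝ)) (hO : MeasurableSet O) :
    (n.descFactorial (J + 1) : ℝ≥0∞) * ∫⁻ a, (increasingPos J ∩ O).indicator
        (fun a => ENNReal.ofReal (1 - a (Fin.last J)) ^ (n - (J + 1))) a ≤
      uniformCube (Fin n) (⋃ σ : Fin (J + 1) ↪ Fin n, lowestAt σ ∩ {u | u ∘ σ ∈ O}) := by
  rw [measure_iUnion]
  · rw [tsum_fintype]
    refine le_trans (le_of_eq ?_) (Finset.sum_le_sum fun σ _ => le_uniformCube_lowestAt hJ σ O hO)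
    rw [Finset.sum_const, Finset.card_univ, Fintype.card_embedding_eq, Fintype.card_fin,
      Fintype.card_fin, nsmul_eq_mul]
  · exact fun σ τ h => (pairwise_disjoint_lowestAt n J h).mono Set.inter_subset_left
      Set.inter_subset_left
  · exact fun σ => (measurableSet_lowestAt σ).inter
      ((measurable_pi_lambda _ fun a => measurable_pi_apply (σ a)) hO)

/-! ### Weak convergence of the top order statistics -/

lemma tendsto_descFactorial_mul_one_sub_pow (J : ℕ) (u : ℝ) :
    Tendsto (fun n : ℕ => (n.descFactorial (J + 1) : ℝ) * (((n : ℝ) ^ (J + 1))⁻¹ *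
      (1 - u / n) ^ (n - (J + 1)))) atTop (𝓝 (Real.exp (-u))) := by
  have hn0 : ∀ᶠ n : ℕ in atTop, (n : ℝ) ^ (J + 1) ≠ 0 := by
    filter_upwards [eventually_gt_atTop 0] with n hn
    positivity
  have h1 : Tendsto (fun n : ℕ => (n.descFactorial (J + 1) : ℝ) / (n : ℝ) ^ (J + 1)) atTop
      (𝓝 1) :=
    (Asymptotics.isEquivalent_iff_tendsto_one hn0).1 (isEquivalent_descFactorial (J + 1))
  have h2 : Tendsto (fun n : ℕ => (1 - u / n) ^ n) atTop (𝓝 (Real.exp (-u))) := by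
    refine (Real.tendsto_one_add_div_pow_exp (-u)).congr fun n => ?_
    congr 1
    ring
  have h3 : Tendsto (fun n : ℕ => 1 - u / (n : ℝ)) atTop (𝓝 1) := by
    simpa using (tendsto_const_div_atTop_nhds_zero_nat u).const_sub 1
  have h4 : Tendsto (fun n : ℕ => (1 - u / (n : ℝ)) ^ (J + 1)) atTop (𝓝 1) := by
    simpa using h3.pow (J + 1)
  have h5 := h1.mul (h2.div h4 one_ne_zero)
  rw [one_mul, div_one] at h5
  refine h5.congr' ?_
  filter_upwards [eventually_ge_atTop (J + 1),
    h3.eventually (lt_mem_nhds (zero_lt_one' ℝ))] with n hn hpos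
  simp only [Pi.div_apply]
  rw [pow_sub₀ _ hpos.ne' hn, div_eq_mul_inv, div_eq_mul_inv, mul_assoc]

lemma lintegral_comp_inv_smul {J : ℕ} {n : ℕ} (hn : 0 < n) (g : (Fin J → ℝ) → ℝ≥0∞)
    (hg : Measurable g) :
    ∫⁻ u, ENNReal.ofReal (((n : ℝ) ^ J)⁻¹) * g ((n : ℝ)⁻¹ • u) = ∫⁻ a, g a := by
  have hn' : (0 : ℝ) < n := by exact_mod_cast hn
  have h := Measure.map_addHaar_smul (volume : Measure (Fin J → ℝ)) (inv_ne_zero hn'.ne')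
  rw [lintegral_const_mul _ (by fun_prop),
    ← lintegral_map (μ := volume) (f := g) (g := fun u : Fin J → ℝ => (n : ℝ)⁻¹ • u) hg
      (by fun_prop), h, lintegral_smul_measure, smul_eq_mul, ← mul_assoc,
    ← ENNReal.ofReal_mul (by positivity)]
  rw [Module.finrank_fin_fun, abs_of_nonneg (by positivity), inv_pow, inv_inv,
    inv_mul_cancel₀ (by positivity), ENNReal.ofReal_one, one_mul]

section

variable {Ω : Type*} [MeasurableSpace Ω] {P : Measure Ω}
  {Ω' : Type*} [MeasurableSpace Ω'] {P' : Measure Ω'}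

/-- A lower bound for the law of the top order statistics of an i.i.d. sample, obtained by writing
the sample as the image of a uniform sample under the tail quantile function. -/
lemma descFactorial_mul_lintegral_le_kthLargest {ν : Measure ℝ} [IsProbabilityMeasure ν]
    {V : ℕ → Ω → ℝ} (hV_law : ∀ i, HasLaw (V i) ν P) (hV_indep : iIndepFun V P)
    {n J : ℕ} (hJ : J + 1 < n) (G : Set (Fin (J + 1) → ℝ)) (hG : MeasurableSet G) :
    (n.descFactorial (J + 1) : ℝ≥0∞) * ∫⁻ a,
        (increasingPos J ∩ {a | (fun j => tailQuantile ν (a j)) ∈ G}).indicator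
          (fun a => ENNReal.ofReal (1 - a (Fin.last J)) ^ (n - (J + 1))) a ≤
      P {ω | (fun j : Fin (J + 1) => kthLargest (fun i : Fin n => V i ω) j) ∈ G} := by
  have hlaw : HasLaw (fun ω (i : Fin n) => V i ω) (Measure.pi fun _ : Fin n => ν) P :=
    iIndepFun.hasLaw_pi (fun i : Fin n => hV_law i) (hV_indep.precomp Fin.val_injective)
  have hstat : MeasurableSet
      {y : Fin n → ℝ | (fun j : Fin (J + 1) => kthLargest y j) ∈ G} :=
    (measurable_pi_lambda _ fun j : Fin (J + 1) => measurable_kthLargest n j) hG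
  have hQ := measurable_tailQuantile ν
  have hQn : Measurable fun (u : Fin n → ℝ) i => tailQuantile ν (u i) :=
    measurable_pi_lambda _ fun i => hQ.comp (measurable_pi_apply i)
  have hpi : (uniformCube (Fin n)).map (fun u i => tailQuantile ν (u i)) =
      Measure.pi fun _ : Fin n => ν := by
    have hsf : SigmaFinite
        (((volume : Measure ℝ).restrict (Set.Ioo 0 1)).map (tailQuantile ν)) := by
      rw [map_tailQuantile]
      infer_instance
    rw [uniformCube, Measure.pi_map_pi fun _ => hQ.aemeasurable]
    simp_rw [map_tailQuantile]
  have hP : P {ω | (fun j : Fin (J + 1) => kthLargest (fun i : Fin n => V i ω) j) ∈ G} =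
      uniformCube (Fin n)
        {u | (fun j : Fin (J + 1) => kthLargest (fun i => tailQuantile ν (u i)) j) ∈ G} := by
    have := Measure.map_apply_of_aemeasurable hlaw.aemeasurable hstat
    rw [hlaw.map_eq, ← hpi, Measure.map_apply hQn hstat] at this
    exact this.symm
  have hO : MeasurableSet {a : Fin (J + 1) → ℝ | (fun j => tailQuantile ν (a j)) ∈ G} :=
    (measurable_pi_lambda _ fun j => hQ.comp (measurable_pi_apply j)) hG
  refine (descFactorial_mul_lintegral_le hJ _ hO).trans ?_
  rw [hP]
  refine measure_mono_ae ?_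
  have hcube : ∀ᵐ u ∂uniformCube (Fin n), ∀ i, u i ∈ Set.Ioo (0 : ℝ) 1 := by
    refine eventually_countable_forall.2 fun i => ?_
    have := (measurePreserving_eval
      (fun _ : Fin n => (volume : Measure ℝ).restrict (Set.Ioo 0 1)) i).quasiMeasurePreserving
    exact this.ae (ae_restrict_mem measurableSet_Ioo)
  filter_upwards [hcube] with u hu hmem
  obtain ⟨σ, hσ, hσG⟩ := Set.mem_iUnion.1 hmem
  have heq : (fun j : Fin (J + 1) => kthLargest (fun i => tailQuantile ν (u i)) j) =
      fun j => tailQuantile ν (u (σ j)) := by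
    ext j
    exact kthLargest_antitone_comp _ (antitoneOn_tailQuantile ν) u hu σ hσ.1 hσ.2 j
  change (fun j : Fin (J + 1) => kthLargest (fun i => tailQuantile ν (u i)) j) ∈ G
  rw [heq]
  exact hσG

/-- The normalized top order statistics of an i.i.d. sample converge jointly in distribution to a
function of the partial sums of standard exponential variables, as soon as the tail quantile
function at levels `u / n`, normalized in the same way, converges pointwise. After rescaling, the
density of the smallest uniform order statistics converges pointwise to the density of the partial
sums, and Fatou's lemma bounds the limit inferior of the probabilities of open sets. -/
theorem tendstoInDistribution_kthLargest [IsProbabilityMeasure P] [IsProbabilityMeasure P']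
    {ν : Measure ℝ} [IsProbabilityMeasure ν]
    {V : ℕ → Ω → ℝ} (hV_law : ∀ i, HasLaw (V i) ν P) (hV_indep : iIndepFun V P)
    {E : ℕ → Ω' → ℝ} (hE_law : ∀ i, HasLaw (E i) (expMeasure 1) P') (hE_indep : iIndepFun E P')
    (J : ℕ) (q₁ : ℝ) (z : ℕ → ℝ) (φ : ℝ → ℝ) (hφ : Measurable φ)
    (hlim : ∀ u : ℝ, 0 < u →
      Tendsto (fun n : ℕ => (tailQuantile ν (u / n) - q₁) / z n) atTop (𝓝 (φ u))) :
    TendstoInDistribution (fun (n : ℕ) ω (j : Fin (J + 1)) =>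
        (kthLargest (fun i : Fin n => V i ω) j - q₁) / z n) atTop
      (fun ω j => φ (∑ i ∈ Finset.range (j + 1), E i ω)) (fun _ => P) P' := by
  have hVm : ∀ i, AEMeasurable (V i) P := fun i => (hV_law i).aemeasurable
  have hEm : ∀ i, AEMeasurable (E i) P' := fun i => (hE_law i).aemeasurable
  have hTm : ∀ n : ℕ, AEMeasurable (fun ω (j : Fin (J + 1)) =>
      (kthLargest (fun i : Fin n => V i ω) j - q₁) / z n) P := fun n =>
    aemeasurable_pi_lambda _ fun j => (((measurable_kthLargest n j).comp_aemeasurable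
      (aemeasurable_pi_lambda _ fun i => hVm i)).sub_const q₁).div_const (z n)
  have hφJ : Measurable fun (u : Fin (J + 1) → ℝ) j => φ (u j) :=
    measurable_pi_lambda _ fun j => hφ.comp (measurable_pi_apply j)
  have hLm : AEMeasurable (fun ω (j : Fin (J + 1)) => φ (∑ i ∈ Finset.range (j + 1), E i ω)) P' :=
    aemeasurable_pi_lambda _ fun j => hφ.comp_aemeasurable
      (Finset.aemeasurable_fun_sum _ fun i _ => hEm i)
  refine ⟨hTm, hLm, tendsto_of_forall_isOpen_le_liminf' fun G hG => ?_⟩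
  have hGm := hG.measurableSet
  simp only [ProbabilityMeasure.coe_mk]
  -- The normalization as a map `c n` of vectors of order statistics.
  set c : ℕ → (Fin (J + 1) → ℝ) → (Fin (J + 1) → ℝ) := fun n y j => (y j - q₁) / z n with hc
  have hcm : ∀ n, Measurable (c n) := fun n =>
    measurable_pi_lambda _ fun j => by
      simp only [hc]
      fun_prop
  set g : ℕ → (Fin (J + 1) → ℝ) → ℝ≥0∞ := fun n =>
    (increasingPos J ∩ {a | (fun j => tailQuantile ν (a j)) ∈ c n ⁻¹' G}).indicator
      (fun a => ENNReal.ofReal (1 - a (Fin.last J)) ^ (n - (J + 1))) with hg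
  have hgm : ∀ n, Measurable (g n) := fun n => by
    refine Measurable.indicator (by fun_prop) ((measurableSet_increasingPos J).inter ?_)
    exact (measurable_pi_lambda _ fun j =>
      (measurable_tailQuantile ν).comp (measurable_pi_apply j)) (hcm n hGm)
  have hleft : (P'.map fun ω (j : Fin (J + 1)) => φ (∑ i ∈ Finset.range (j + 1), E i ω)) G =
      ∫⁻ u, partialSumDensity J u * ((fun u j => φ (u j)) ⁻¹' G).indicator 1 u := by
    rw [← lintegral_partialSum hE_law hE_indep J _
      ((measurable_one).indicator (hφJ hGm)), ← lintegral_indicator_one hGm,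
      lintegral_map' ((measurable_one).indicator hGm).aemeasurable hLm]
    rfl
  have hright : ∀ᶠ n : ℕ in atTop, ∫⁻ u, (n.descFactorial (J + 1) : ℝ≥0∞) *
      (ENNReal.ofReal (((n : ℝ) ^ (J + 1))⁻¹) * g n ((n : ℝ)⁻¹ • u)) ≤
        (P.map fun ω (j : Fin (J + 1)) =>
          (kthLargest (fun i : Fin n => V i ω) j - q₁) / z n) G := by
    filter_upwards [eventually_gt_atTop (J + 1)] with n hn
    have hm : Measurable fun u : Fin (J + 1) → ℝ => g n ((n : ℝ)⁻¹ • u) :=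
      (hgm n).comp (measurable_const_smul _)
    rw [lintegral_const_mul _ (hm.const_mul _),
      lintegral_comp_inv_smul (by omega) _ (hgm n),
      Measure.map_apply_of_aemeasurable (hTm n) hGm]
    exact descFactorial_mul_lintegral_le_kthLargest hV_law hV_indep hn _ (hcm n hGm)
  have hpt : ∀ u, partialSumDensity J u * ((fun u j => φ (u j)) ⁻¹' G).indicator 1 u ≤
      liminf (fun n : ℕ => (n.descFactorial (J + 1) : ℝ≥0∞) *
        (ENNReal.ofReal (((n : ℝ) ^ (J + 1))⁻¹) * g n ((n : ℝ)⁻¹ • u))) atTop := by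
    intro u
    by_cases hu : u ∈ increasingPos J
    swap
    · rw [partialSumDensity, Set.indicator_of_notMem hu, zero_mul]
      exact zero_le
    by_cases huG : u ∈ (fun (u : Fin (J + 1) → ℝ) j => φ (u j)) ⁻¹' G
    swap
    · rw [Set.indicator_of_notMem huG, mul_zero]
      exact zero_le
    rw [partialSumDensity, Set.indicator_of_mem hu, Set.indicator_of_mem huG, Pi.one_apply, mul_one]
    have hupos : ∀ j, 0 < u j := fun j => hu.1.trans_le (hu.2.monotone (Fin.zero_le j))
    have hcn : Tendsto (fun n : ℕ => c n fun j => tailQuantile ν (((n : ℝ)⁻¹ • u) j)) atTop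
        (𝓝 fun j => φ (u j)) := by
      refine tendsto_pi_nhds.2 fun j => (hlim (u j) (hupos j)).congr fun n => ?_
      simp only [hc, Pi.smul_apply, smul_eq_mul]
      rw [div_eq_inv_mul (u j)]
    have hlast : Tendsto (fun n : ℕ => 1 - u (Fin.last J) / (n : ℝ)) atTop (𝓝 1) := by
      simpa using (tendsto_const_div_atTop_nhds_zero_nat (u (Fin.last J))).const_sub 1
    have hconv := (ENNReal.continuous_ofReal.tendsto _).comp
      (tendsto_descFactorial_mul_one_sub_pow J (u (Fin.last J)))
    refine le_of_eq (Tendsto.liminf_eq (hconv.congr' ?_)).symm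
    filter_upwards [hcn.eventually (hG.mem_nhds huG), eventually_gt_atTop 0,
      hlast.eventually (lt_mem_nhds (zero_lt_one' ℝ))] with n hnG hn0 hn1
    have hn0' : (0 : ℝ) < n := by exact_mod_cast hn0
    have hmem : (n : ℝ)⁻¹ • u ∈
        increasingPos J ∩ {a | (fun j => tailQuantile ν (a j)) ∈ c n ⁻¹' G} := by
      refine ⟨⟨mul_pos (inv_pos.2 hn0') hu.1, fun a b hab => ?_⟩, hnG⟩
      exact mul_lt_mul_of_pos_left (hu.2 hab) (inv_pos.2 hn0')
    rw [hg]
    simp only []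
    rw [Set.indicator_of_mem hmem, Function.comp_apply, ENNReal.ofReal_mul (by positivity),
      ENNReal.ofReal_natCast, ENNReal.ofReal_mul (by positivity), ← ENNReal.ofReal_pow,
      Pi.smul_apply, smul_eq_mul, div_eq_inv_mul]
    rw [Pi.smul_apply, smul_eq_mul, ← div_eq_inv_mul]
    exact hn1.le
  rw [hleft]
  calc _ ≤ ∫⁻ u, liminf (fun n : ℕ => (n.descFactorial (J + 1) : ℝ≥0∞) *
        (ENNReal.ofReal (((n : ℝ) ^ (J + 1))⁻¹) * g n ((n : ℝ)⁻¹ • u))) atTop :=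
        lintegral_mono hpt
    _ ≤ liminf (fun n : ℕ => ∫⁻ u, (n.descFactorial (J + 1) : ℝ≥0∞) *
        (ENNReal.ofReal (((n : ℝ) ^ (J + 1))⁻¹) * g n ((n : ℝ)⁻¹ • u))) atTop :=
        lintegral_liminf_le fun n =>
          (((hgm n).comp (measurable_const_smul _)).const_mul _).const_mul _
    _ ≤ _ := liminf_le_liminf hright

end

/-! ### Convergence of the posterior risk and of its minimizers -/

lemma lintegral_comp_affine {s : ℝ} (hs : 0 < s) (c : ℝ) (F : ℝ → ℝ≥0∞) (hF : Measurable F) :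
    ∫⁻ t, F t = ENNReal.ofReal s * ∫⁻ v, F (c + s * v) := by
  have h := Real.smul_map_volume_mul_left hs.ne'
  rw [abs_of_pos hs] at h
  rw [← lintegral_add_left_eq_self F c]
  conv_lhs => rw [← h]
  rw [lintegral_smul_measure, lintegral_map (by fun_prop) (by fun_prop), smul_eq_mul]

/-- The posterior risk in the local coordinate `v = (t - c) / s`: the scale `s` enters only through
the prior. -/
lemma posteriorRisk_local {L : ℕ} {ρ prior : ℝ → ℝ} {g : (Fin L → ℝ) → ℝ} (hρ : Measurable ρ)
    (hprior : Measurable prior) (hg : Measurable g) {s : ℝ} (hs : 0 < s) (c : ℝ)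
    (w : Fin L → ℝ) (z : ℝ) :
    posteriorRisk ρ prior g s⁻¹ (fun l => c + s * w l) (c + s * z) =
      (∫⁻ v, ENNReal.ofReal (ρ (z - v)) *
        ENNReal.ofReal (g (fun l => w l - v) * prior (c + s * v))) /
      ∫⁻ v, ENNReal.ofReal (1 : ℝ) *
        ENNReal.ofReal (g (fun l => w l - v) * prior (c + s * v)) := by
  have hsupp : ∀ F : ℝ → ℝ≥0∞, (∀ t, prior t = 0 → F t = 0) →
      ∫⁻ t in Function.support prior, F t = ∫⁻ t, F t := by
    intro F hF
    rw [← lintegral_indicator (measurableSet_support hprior)]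
    refine lintegral_congr fun t => ?_
    by_cases ht : t ∈ Function.support prior
    · rw [Set.indicator_of_mem ht]
    · rw [Set.indicator_of_notMem ht, hF t (Function.notMem_support.1 ht)]
  have hgm : ∀ b : Fin L → ℝ, ∀ a : ℝ, Measurable fun t : ℝ => g fun l => a * (b l - t) :=
    fun b a => hg.comp (measurable_pi_lambda _ fun l => by fun_prop)
  have hloc : ∀ y v : ℝ, s⁻¹ * (c + s * y - (c + s * v)) = y - v := by
    intro y v
    field_simp
    ring
  rw [posteriorRisk, hsupp, hsupp]
  rotate_left
  · intro t ht
    simp [ht]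
  · intro t ht
    simp [ht]
  simp_rw [div_eq_mul_inv, ← mul_assoc]
  have hgm' := hgm (fun l => c + s * w l) s⁻¹
  rw [lintegral_mul_const _ (by fun_prop), lintegral_comp_affine hs c _ (by fun_prop),
    lintegral_comp_affine hs c (fun t => ENNReal.ofReal (g (fun l => s⁻¹ * (c + s * w l - t)) *
      prior t)) (by fun_prop)]
  simp_rw [hloc, ENNReal.ofReal_one, one_mul]
  rw [← div_eq_mul_inv, ← div_eq_mul_inv]
  exact ENNReal.mul_div_mul_left _ _ (by simpa using hs) ENNReal.ofReal_ne_top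

lemma limitRisk_eq_div {L : ℕ} {ρ : ℝ → ℝ} {g : (Fin L → ℝ) → ℝ} (hρ : Measurable ρ)
    (hg : Measurable g) (w : Fin L → ℝ) (z : ℝ) :
    limitRisk ρ g w z = (∫⁻ v, ENNReal.ofReal (ρ (z - v)) * ENNReal.ofReal (g fun l => w l - v)) /
      ∫⁻ v, ENNReal.ofReal (g fun l => w l - v) := by
  have hgm : Measurable fun t : ℝ => g fun l => w l - t :=
    hg.comp (measurable_pi_lambda _ fun l => by fun_prop)
  rw [limitRisk]
  simp_rw [div_eq_mul_inv, ← mul_assoc]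
  rw [lintegral_mul_const _ (by fun_prop)]

/-- Integrals of convex functions of a parameter inherit convexity; in the form needed for
minimizers, and with values in `[0, ∞]`. -/
lemma lintegral_le_of_mem_segment {α : Type*} [MeasurableSpace α] (μ : Measure α)
    (h : ℝ → α → ℝ) (h0 : ∀ z t, 0 ≤ h z t) (hconv : ∀ t, ConvexOn ℝ Set.univ fun z => h z t)
    (hm : ∀ z, Measurable (h z)) (K : α → ℝ≥0∞) (hK : Measurable K) {a b z : ℝ}
    (hz : z ∈ segment ℝ a b)
    (hab : ∫⁻ t, ENNReal.ofReal (h b t) * K t ∂μ ≤ ∫⁻ t, ENNReal.ofReal (h a t) * K t ∂μ) :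
    ∫⁻ t, ENNReal.ofReal (h z t) * K t ∂μ ≤ ∫⁻ t, ENNReal.ofReal (h a t) * K t ∂μ := by
  obtain ⟨p, q, hp, hq, hpq, rfl⟩ := hz
  have hpt : ∀ t, ENNReal.ofReal (h (p • a + q • b) t) * K t ≤
      ENNReal.ofReal p * (ENNReal.ofReal (h a t) * K t) +
        ENNReal.ofReal q * (ENNReal.ofReal (h b t) * K t) := by
    intro t
    rw [← mul_assoc, ← mul_assoc, ← add_mul, ← ENNReal.ofReal_mul hp, ← ENNReal.ofReal_mul hq,
      ← ENNReal.ofReal_add (mul_nonneg hp (h0 _ _)) (mul_nonneg hq (h0 _ _))]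
    gcongr
    exact (hconv t).2 (Set.mem_univ a) (Set.mem_univ b) hp hq hpq
  have hma := hm a
  have hmb := hm b
  calc _ ≤ ∫⁻ t, ENNReal.ofReal p * (ENNReal.ofReal (h a t) * K t) +
        ENNReal.ofReal q * (ENNReal.ofReal (h b t) * K t) ∂μ := lintegral_mono hpt
    _ = ENNReal.ofReal p * ∫⁻ t, ENNReal.ofReal (h a t) * K t ∂μ +
        ENNReal.ofReal q * ∫⁻ t, ENNReal.ofReal (h b t) * K t ∂μ := by
      rw [lintegral_add_left (by fun_prop), lintegral_const_mul _ (by fun_prop),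
        lintegral_const_mul _ (by fun_prop)]
    _ ≤ ENNReal.ofReal p * ∫⁻ t, ENNReal.ofReal (h a t) * K t ∂μ +
        ENNReal.ofReal q * ∫⁻ t, ENNReal.ofReal (h a t) * K t ∂μ := by gcongr
    _ = _ := by rw [← add_mul, ← ENNReal.ofReal_add hp hq, hpq, ENNReal.ofReal_one, one_mul]

/-- The posterior risk is quasi-convex in the decision. -/
lemma posteriorRisk_le_of_mem_segment {L : ℕ} {ρ prior : ℝ → ℝ} {g : (Fin L → ℝ) → ℝ}
    (hρ : Measurable ρ) (hρ0 : ∀ u, 0 ≤ ρ u) (hρc : ConvexOn ℝ Set.univ ρ)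
    (hprior : Measurable prior) (hg : Measurable g) (α c s : ℝ) (w : Fin L → ℝ) {a b z : ℝ}
    (hz : z ∈ segment ℝ a b)
    (hab : posteriorRisk ρ prior g α w (c + s * b) ≤ posteriorRisk ρ prior g α w (c + s * a)) :
    posteriorRisk ρ prior g α w (c + s * z) ≤ posteriorRisk ρ prior g α w (c + s * a) := by
  have hgm : Measurable fun t : ℝ => g fun l => α * (w l - t) :=
    hg.comp (measurable_pi_lambda _ fun l => by fun_prop)
  refine lintegral_le_of_mem_segment _ (fun z t => ρ (α * (c + s * z - t))) (fun _ _ => hρ0 _)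
    (fun t => ⟨convex_univ, fun x _ y _ p q hp hq hpq => ?_⟩) (fun z => by fun_prop) _
    (by fun_prop) hz hab
  have heq : α * (c + s * (p • x + q • y) - t) =
      p • (α * (c + s * x - t)) + q • (α * (c + s * y - t)) := by
    simp only [smul_eq_mul]
    have : q = 1 - p := by linarith
    subst this
    ring
  simp only [heq]
  exact hρc.2 (Set.mem_univ _) (Set.mem_univ _) hp hq hpq

/-- Minimizers of quasi-convex functions on the line converge if the functions converge pointwise
to a function with a unique minimizer. -/
lemma tendsto_of_isMin_of_segment {Q : ℕ → ℝ → ℝ≥0∞} {Q₀ : ℝ → ℝ≥0∞} {e : ℕ → ℝ} {z₀ : ℝ}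
    (hQ : ∀ᶠ j in atTop, ∀ a b z, z ∈ segment ℝ a b → Q j b ≤ Q j a → Q j z ≤ Q j a)
    (hlim : ∀ z, Tendsto (fun j => Q j z) atTop (𝓝 (Q₀ z)))
    (hmin : ∀ z, z ≠ z₀ → Q₀ z₀ < Q₀ z) (he : ∀ᶠ j in atTop, Q j (e j) ≤ Q j z₀) :
    Tendsto e atTop (𝓝 z₀) := by
  refine tendsto_order.2 ⟨fun a ha => ?_, fun a ha => ?_⟩
  · filter_upwards [hQ, he, (hlim z₀).eventually_lt (hlim a) (hmin a ha.ne)] with j h1 h2 h3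
    by_contra! h
    refine absurd (h1 z₀ (e j) a ?_ h2) (not_le.2 h3)
    rw [segment_symm, segment_eq_Icc (h.trans ha.le)]
    exact ⟨h, ha.le⟩
  · filter_upwards [hQ, he, (hlim z₀).eventually_lt (hlim a) (hmin a ha.ne')] with j h1 h2 h3
    by_contra! h
    refine absurd (h1 z₀ (e j) a ?_ h2) (not_le.2 h3)
    rw [segment_eq_Icc (ha.le.trans h)]
    exact ⟨ha.le, h⟩

section Limit

variable {L : ℕ} {f : ℝ × ℝ → (Fin L → ℝ) → ℝ} {θ₀ : ℝ × ℝ} {prior : ℝ → ℝ} {B r C Cp q₁ : ℝ}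

/-- Dominated convergence for the numerator and the denominator of the posterior risk. The decay
of the densities in the single coordinate `l` dominates a weight of growth order `B`. -/
lemma tendsto_lintegral_likelihood (l : Fin L)
    (hfm : ∀ᶠ θ in 𝓝 θ₀, Measurable (f θ)) (hf0 : ∀ᶠ θ in 𝓝 θ₀, ∀ x, 0 ≤ f θ x)
    (hf_cont : ∀ x : Fin L → ℝ,
      ContinuousAt (fun p : (ℝ × ℝ) × (Fin L → ℝ) => f p.1 p.2) (θ₀, x))
    (hB : 0 ≤ B) (hr : B + 1 < r)
    (hdecay : ∀ᶠ θ in 𝓝 θ₀, ∀ x : Fin L → ℝ, f θ x ≤ C * (1 + |x l|) ^ (-r))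
    (hprior : Measurable prior) (hprior0 : ∀ t, 0 ≤ prior t) (hpriorb : ∀ t, prior t ≤ Cp)
    (hpriorc : ContinuousAt prior q₁)
    {s : ℕ → ℝ} {w : ℕ → Fin L → ℝ} {θ : ℕ → ℝ × ℝ} {w₀ : Fin L → ℝ}
    (hs : Tendsto s atTop (𝓝 0)) (hw : Tendsto w atTop (𝓝 w₀)) (hθ : Tendsto θ atTop (𝓝 θ₀))
    (ψ : ℝ → ℝ) (hψ : Measurable ψ) (hψ0 : ∀ v, 0 ≤ ψ v) (A : ℝ)
    (hψA : ∀ v, ψ v ≤ A * (1 + |w₀ l - v|) ^ B) :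
    Tendsto (fun j => ∫⁻ v, ENNReal.ofReal (ψ v) *
        ENNReal.ofReal (f (θ j) (fun l => w j l - v) * prior (q₁ + s j * v))) atTop
      (𝓝 ((∫⁻ v, ENNReal.ofReal (ψ v) * ENNReal.ofReal (f θ₀ fun l => w₀ l - v)) *
        ENNReal.ofReal (prior q₁))) ∧
    (∫⁻ v, ENNReal.ofReal (ψ v) * ENNReal.ofReal (f θ₀ fun l => w₀ l - v)) ≠ ∞ := by
  have hf0' := hf0.self_of_nhds
  have hfm' := hfm.self_of_nhds
  have hC0 : 0 ≤ C := by
    have := (hf0' fun _ => 0).trans (hdecay.self_of_nhds fun _ => 0)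
    simpa using this
  have hA0 : 0 ≤ A := by
    have := (hψ0 (w₀ l)).trans (hψA (w₀ l))
    simpa using this
  have hmeasf : ∀ (g : (Fin L → ℝ) → ℝ), Measurable g → ∀ b : Fin L → ℝ,
      Measurable fun v : ℝ => g fun l => b l - v := fun g hg b =>
    hg.comp (measurable_pi_lambda _ fun l => by fun_prop)
  -- The dominating function is integrable because `r - B > 1`.
  have hint : Integrable fun v : ℝ => (1 + |w₀ l - v|) ^ (-(r - B)) := by
    have h := integrable_one_add_norm (E := ℝ) (μ := volume) (r := r - B) (by simp; linarith)
    simpa only [Real.norm_eq_abs] using h.comp_sub_left (w₀ l)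
  have hmulpow : ∀ x : ℝ, (1 + |x|) ^ B * (1 + |x|) ^ (-r) = (1 + |x|) ^ (-(r - B)) := by
    intro x
    rw [← Real.rpow_add (by positivity)]
    congr 1
    ring
  have hfin : (∫⁻ v, ENNReal.ofReal (ψ v) * ENNReal.ofReal (f θ₀ fun l => w₀ l - v)) ≠ ∞ := by
    refine ne_top_of_le_ne_top (hint.const_mul (A * C)).lintegral_lt_top.ne
      (lintegral_mono fun v => ?_)
    rw [← ENNReal.ofReal_mul (hψ0 v), ← hmulpow]
    refine ENNReal.ofReal_le_ofReal ?_
    calc _ ≤ (A * (1 + |w₀ l - v|) ^ B) * (C * (1 + |w₀ l - v|) ^ (-r)) :=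
          mul_le_mul (hψA v) (hdecay.self_of_nhds _) (hf0' _) ((hψ0 v).trans (hψA v))
      _ = _ := by ring
  refine ⟨?_, hfin⟩
  have hm0 := hmeasf _ hfm' w₀
  rw [← lintegral_mul_const _ (by fun_prop)]
  refine tendsto_lintegral_filter_of_dominated_convergence
    (fun v => ENNReal.ofReal (A * C * 2 ^ r * Cp * (1 + |w₀ l - v|) ^ (-(r - B)))) ?_ ?_
    (hint.const_mul (A * C * 2 ^ r * Cp)).lintegral_lt_top.ne ?_
  · filter_upwards [hθ.eventually hfm] with j hj
    have := hmeasf _ hj (w j)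
    fun_prop
  · have hwl : Tendsto (fun j => w j l) atTop (𝓝 (w₀ l)) := (tendsto_pi_nhds.1 hw) l
    filter_upwards [hθ.eventually hdecay, hθ.eventually hf0,
      hwl.eventually (Metric.closedBall_mem_nhds _ one_pos)] with j hj hj0 hjw
    refine ae_of_all _ fun v => ?_
    rw [← ENNReal.ofReal_mul (hψ0 v), ← hmulpow]
    refine ENNReal.ofReal_le_ofReal ?_
    have hjw' : |w j l - w₀ l| ≤ 1 := hjw
    -- A shift of the centre by at most `1` changes `1 + |· - v|` by a factor of at most `2`.
    have hhalf : (1 + |w₀ l - v|) / 2 ≤ 1 + |w j l - v| := by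
      have h1 : |w₀ l - v| ≤ |w j l - w₀ l| + |w j l - v| := by
        rw [abs_sub_comm (w j l) (w₀ l)]
        exact abs_sub_le _ _ _
      have := abs_nonneg (w j l - v)
      linarith
    have hpow : (1 + |w j l - v|) ^ (-r) ≤ 2 ^ r * (1 + |w₀ l - v|) ^ (-r) := by
      calc (1 + |w j l - v|) ^ (-r) ≤ ((1 + |w₀ l - v|) / 2) ^ (-r) :=
            Real.rpow_le_rpow_of_nonpos (by positivity) hhalf (by linarith)
        _ = 2 ^ r * (1 + |w₀ l - v|) ^ (-r) := by
          rw [Real.div_rpow (by positivity) zero_le_two, Real.rpow_neg zero_le_two, div_inv_eq_mul,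
            mul_comm]
    have hfj : f (θ j) (fun l => w j l - v) ≤ C * (2 ^ r * (1 + |w₀ l - v|) ^ (-r)) :=
      (hj _).trans (mul_le_mul_of_nonneg_left hpow hC0)
    have hCp : 0 ≤ Cp := (hprior0 0).trans (hpriorb 0)
    calc _ ≤ (A * (1 + |w₀ l - v|) ^ B) * (C * (2 ^ r * (1 + |w₀ l - v|) ^ (-r)) * Cp) :=
          mul_le_mul (hψA v) (mul_le_mul hfj (hpriorb _) (hprior0 _) ((hj0 _).trans hfj))
            (mul_nonneg (hj0 _) (hprior0 _)) ((hψ0 v).trans (hψA v))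
      _ = _ := by ring
  · refine ae_of_all _ fun v => ?_
    rw [mul_assoc, ← ENNReal.ofReal_mul (hf0' _)]
    refine ENNReal.Tendsto.const_mul ?_ (Or.inr ENNReal.ofReal_ne_top)
    refine (ENNReal.continuous_ofReal.tendsto _).comp (Tendsto.mul ?_ ?_)
    · have hwv : Tendsto (fun j l => w j l - v) atTop (𝓝 fun l => w₀ l - v) :=
        tendsto_pi_nhds.2 fun l => ((tendsto_pi_nhds.1 hw) l).sub_const v
      exact (hf_cont fun l => w₀ l - v).tendsto.comp (hθ.prodMk_nhds hwv)
    · have : Tendsto (fun j => q₁ + s j * v) atTop (𝓝 q₁) := by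
        simpa using (hs.mul_const v).const_add q₁
      exact hpriorc.tendsto.comp this

/-- The posterior risk in local coordinates converges pointwise to the limiting risk; the factor
`prior q₁` cancels between numerator and denominator. -/
lemma tendsto_posteriorRisk {ρ : ℝ → ℝ} (hρ : Measurable ρ) (hρ0 : ∀ u, 0 ≤ ρ u) {Cρ : ℝ}
    (hρ_growth : ∀ u, ρ u ≤ Cρ * (1 + |u| ^ B)) (l : Fin L)
    (hfm : ∀ᶠ θ in 𝓝 θ₀, Measurable (f θ)) (hf0 : ∀ᶠ θ in 𝓝 θ₀, ∀ x, 0 ≤ f θ x)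
    (hf_cont : ∀ x : Fin L → ℝ,
      ContinuousAt (fun p : (ℝ × ℝ) × (Fin L → ℝ) => f p.1 p.2) (θ₀, x))
    (hB : 0 ≤ B) (hr : B + 1 < r)
    (hdecay : ∀ᶠ θ in 𝓝 θ₀, ∀ x : Fin L → ℝ, f θ x ≤ C * (1 + |x l|) ^ (-r))
    (hprior : Measurable prior) (hprior0 : ∀ t, 0 ≤ prior t) (hpriorb : ∀ t, prior t ≤ Cp)
    (hpriorc : ContinuousAt prior q₁) (hprior_pos : 0 < prior q₁)
    {s : ℕ → ℝ} {w : ℕ → Fin L → ℝ} {θ : ℕ → ℝ × ℝ} {w₀ : Fin L → ℝ}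
    (hs : Tendsto s atTop (𝓝 0)) (hs0 : ∀ᶠ j in atTop, 0 < s j)
    (hw : Tendsto w atTop (𝓝 w₀)) (hθ : Tendsto θ atTop (𝓝 θ₀))
    (hpos : ∫⁻ v, ENNReal.ofReal (f θ₀ fun l => w₀ l - v) ≠ 0) (z : ℝ) :
    Tendsto (fun j => posteriorRisk ρ prior (f (θ j)) (s j)⁻¹ (fun l => q₁ + s j * w j l)
      (q₁ + s j * z)) atTop (𝓝 (limitRisk ρ (f θ₀) w₀ z)) := by
  have hone : ∀ x : ℝ, 1 ≤ (1 + |x|) ^ B := fun x =>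
    Real.one_le_rpow (by linarith [abs_nonneg x]) hB
  have hCρ : 0 ≤ Cρ := by
    have h := (hρ0 1).trans (hρ_growth 1)
    rw [abs_one, Real.one_rpow] at h
    linarith
  have hnum := (tendsto_lintegral_likelihood l hfm hf0 hf_cont hB hr hdecay hprior hprior0
    hpriorb hpriorc hs hw hθ (fun v => ρ (z - v)) (by fun_prop) (fun v => hρ0 _)
    (Cρ * (1 + (1 + |z - w₀ l|) ^ B)) (fun v => by
      refine (hρ_growth _).trans ?_
      rw [mul_assoc]
      refine mul_le_mul_of_nonneg_left ?_ hCρ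
      have h1 : |z - v| ≤ (1 + |z - w₀ l|) * (1 + |w₀ l - v|) := by
        have := abs_sub_le z (w₀ l) v
        have h2 := mul_nonneg (abs_nonneg (z - w₀ l)) (abs_nonneg (w₀ l - v))
        nlinarith
      have h2 : |z - v| ^ B ≤ (1 + |z - w₀ l|) ^ B * (1 + |w₀ l - v|) ^ B := by
        rw [← Real.mul_rpow (by positivity) (by positivity)]
        exact Real.rpow_le_rpow (abs_nonneg _) h1 hB
      have := hone (w₀ l - v)
      rw [add_mul, one_mul]
      linarith)).1
  have hden := tendsto_lintegral_likelihood l hfm hf0 hf_cont hB hr hdecay hprior hprior0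
    hpriorb hpriorc hs hw hθ (fun _ => 1) measurable_const (fun _ => zero_le_one) 1
    (fun v => by rw [one_mul]; exact hone _)
  have hp0 : ENNReal.ofReal (prior q₁) ≠ 0 := by simpa using hprior_pos
  have hlim := ENNReal.Tendsto.div hnum (Or.inr (mul_ne_zero (by simpa using hpos) hp0)) hden.1
    (Or.inl (ENNReal.mul_ne_top hden.2 ENNReal.ofReal_ne_top))
  rw [ENNReal.mul_div_mul_right _ _ hp0 ENNReal.ofReal_ne_top] at hlim
  rw [limitRisk_eq_div hρ hfm.self_of_nhds]
  simp only [ENNReal.ofReal_one, one_mul] at hlim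
  refine hlim.congr' ?_
  filter_upwards [hs0, hθ.eventually hfm] with j hj hjm
  rw [posteriorRisk_local hρ hprior hjm hj]
  simp only [ENNReal.ofReal_one, one_mul]

end Limit

/-- If a random vector has a continuous density `g`, then almost surely the likelihood
`v ↦ g (w - v)` at the observed value `w` has a positive integral. -/
lemma ae_lintegral_translate_ne_zero {Ω' : Type*} [MeasurableSpace Ω'] {P' : Measure Ω'} {L : ℕ}
    {g : (Fin L → ℝ) → ℝ} (hg : Continuous g) {W : Ω' → Fin L → ℝ} (hW : AEMeasurable W P')
    (hlaw : P'.map W = volume.withDensity fun x => ENNReal.ofReal (g x)) :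
    ∀ᵐ ω ∂P', ∫⁻ v : ℝ, ENNReal.ofReal (g fun l => W ω l - v) ≠ 0 := by
  have hcont : Continuous fun p : (Fin L → ℝ) × ℝ => ENNReal.ofReal (g fun l => p.1 l - p.2) :=
    ENNReal.continuous_ofReal.comp (hg.comp (by fun_prop))
  have hI : Measurable fun w : Fin L → ℝ => ∫⁻ v : ℝ, ENNReal.ofReal (g fun l => w l - v) :=
    hcont.measurable.lintegral_prod_right'
  refine ae_of_ae_map (p := fun w : Fin L → ℝ => ∫⁻ v : ℝ, ENNReal.ofReal (g fun l => w l - v) ≠ 0)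
    hW ?_
  rw [hlaw, ae_withDensity_iff (by fun_prop)]
  refine ae_of_all _ fun w hw hzero => hw ?_
  have hc : Continuous fun v : ℝ => ENNReal.ofReal (g fun l => w l - v) :=
    hcont.comp (by fun_prop : Continuous fun v : ℝ => (w, v))
  have h0 := (lintegral_eq_zero_iff hc.measurable).1 hzero
  have h1 := (Continuous.ae_eq_iff_eq volume hc continuous_const).1 h0
  simpa using congrFun h1 0

/-! ### A continuous mapping theorem for relations -/

/-- A continuous mapping theorem in which the image is only described by a relation. Let `V n`
converge in distribution to `V₀` and let `e n` be related to `V n` with probability tending to one.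
If almost every value of `V₀` has the property that, along every sequence tending to that value,
related points converge to the value of `Z`, then `e n` converges in distribution to `Z`. No
measurability of the relation is needed: for a closed set `K`, the closure of the set of points
related to an element of `K` is closed. -/
theorem tendstoInDistribution_of_relation {Ω Ω' S : Type*} [MeasurableSpace Ω] {P : Measure Ω}
    [IsProbabilityMeasure P] [MeasurableSpace Ω'] {P' : Measure Ω'} [IsProbabilityMeasure P']
    [PseudoMetricSpace S] [MeasurableSpace S] [BorelSpace S] {V : ℕ → Ω → S} {V₀ : Ω' → S}
    (hV : TendstoInDistribution V atTop V₀ (fun _ => P) P') {e : ℕ → Ω → ℝ} {Z : Ω' → ℝ}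
    (he : ∀ n, AEMeasurable (e n) P) (hZ : AEMeasurable Z P') (R : S → ℝ → Prop)
    (hR : Tendsto (fun n => P {ω | ¬ R (V n ω) (e n ω)}) atTop (𝓝 0))
    (hlim : ∀ᵐ ω ∂P', ∀ (v : ℕ → S) (x : ℕ → ℝ), Tendsto v atTop (𝓝 (V₀ ω)) →
      (∀ j, R (v j) (x j)) → Tendsto x atTop (𝓝 (Z ω))) :
    TendstoInDistribution e atTop Z (fun _ => P) P' := by
  refine ⟨he, hZ, tendsto_of_forall_isClosed_limsup_le' fun K hK => ?_⟩
  simp only [ProbabilityMeasure.coe_mk]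
  set M : Set S := {v | ∃ x ∈ K, R v x} with hM
  have h1 : ∀ n, (P.map (e n)) K ≤ (P.map (V n)) (closure M) + P {ω | ¬ R (V n ω) (e n ω)} := by
    intro n
    rw [Measure.map_apply_of_aemeasurable (he n) hK.measurableSet,
      Measure.map_apply_of_aemeasurable (hV.forall_aemeasurable n) isClosed_closure.measurableSet]
    refine le_trans (measure_mono fun ω hω => ?_) (measure_union_le _ _)
    by_cases h : R (V n ω) (e n ω)
    · exact Or.inl (subset_closure ⟨e n ω, hω, h⟩)
    · exact Or.inr h
  have h2 := ProbabilityMeasure.limsup_measure_closed_le_of_tendsto hV.tendsto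
    (isClosed_closure (s := M))
  simp only [ProbabilityMeasure.coe_mk] at h2
  calc limsup (fun n => (P.map (e n)) K) atTop
      ≤ limsup ((fun n => (P.map (V n)) (closure M)) + fun n => P {ω | ¬ R (V n ω) (e n ω)})
          atTop := limsup_le_limsup (.of_forall h1)
    _ = limsup (fun n => (P.map (V n)) (closure M)) atTop :=
        ENNReal.limsup_add_of_right_tendsto_zero hR _
    _ ≤ (P'.map V₀) (closure M) := h2
    _ ≤ (P'.map Z) K := by
        rw [Measure.map_apply_of_aemeasurable hZ hK.measurableSet,
          Measure.map_apply_of_aemeasurable hV.aemeasurable_limit isClosed_closure.measurableSet]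
        refine measure_mono_ae ?_
        filter_upwards [hlim] with ω hω hmem
        obtain ⟨v, hv, hvlim⟩ := mem_closure_iff_seq_limit.1 hmem
        choose x hxK hxR using hv
        exact hK.mem_of_tendsto (hω v x hvlim hxR) (.of_forall hxK)

lemma tendstoInMeasure_prodMk {Ω E F : Type*} [MeasurableSpace Ω] {P : Measure Ω}
    [PseudoMetricSpace E] [PseudoMetricSpace F] {u : ℕ → Ω → E} {v : ℕ → Ω → F} {a : Ω → E}
    {b : Ω → F} (hu : TendstoInMeasure P u atTop a) (hv : TendstoInMeasure P v atTop b) :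
    TendstoInMeasure P (fun n ω => (u n ω, v n ω)) atTop (fun ω => (a ω, b ω)) := by
  rw [tendstoInMeasure_iff_dist] at *
  intro ε hε
  have h := (hu ε hε).add (hv ε hε)
  rw [add_zero] at h
  refine tendsto_of_tendsto_of_tendsto_of_le_of_le tendsto_const_nhds h (fun _ => zero_le)
    fun n => le_trans (measure_mono fun ω hω => ?_) (measure_union_le _ _)
  have hω' : ε ≤ max (dist (u n ω) (a ω)) (dist (v n ω) (b ω)) := hω
  exact le_max_iff.1 hω'

/-! ### The sample restricted to small inputs -/

lemma quantileObjective_eq_sum_filter {Ω : Type*} {d : ℕ} (X : ℕ → Ω → Fin d → ℝ)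
    (Y : ℕ → Ω → ℝ) (x : Fin d → ℝ) (n : ℕ) (τ : ℝ) (ω : Ω) (q : ℝ) [DecidablePred fun i : Fin n => X i ω ≤ x] :
    quantileObjective X Y x n τ ω q =
      ∑ i ∈ Finset.univ.filter fun i : Fin n => X i ω ≤ x, checkFun τ (Y i ω - q) := by
  rw [quantileObjective, Finset.sum_range, Finset.sum_filter]
  refine Finset.sum_congr rfl fun i _ => ?_
  by_cases h : X i ω ≤ x
  · rw [if_pos h]
    exact Set.indicator_of_mem (s := {ω | X i ω ≤ x}) h _
  · rw [if_neg h]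
    exact Set.indicator_of_notMem (s := {ω | X i ω ≤ x}) h _

section Sample

variable {Ω : Type*} [MeasurableSpace Ω] {P : Measure Ω} {d : ℕ}

open Classical in
/-- The output of an observation with input at most `x`, and `-1` for any other observation. As
outputs are nonnegative, the large values are those of the observations with input at most `x`. -/
noncomputable def maskedOutput (x : Fin d → ℝ) (w : (Fin d → ℝ) × ℝ) : ℝ :=
  if w.1 ≤ x then w.2 else -1

lemma measurable_maskedOutput (x : Fin d → ℝ) : Measurable (maskedOutput x) :=
  Measurable.ite (measurable_fst measurableSet_Iic) measurable_snd measurable_const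

/-- The share of observations with input at most `x` converges to the probability of such an
observation. -/
lemma tendstoInMeasure_share [IsProbabilityMeasure P] {X : ℕ → Ω → Fin d → ℝ} {Y : ℕ → Ω → ℝ}
    (x : Fin d → ℝ)
    (hX_meas : ∀ i, Measurable (X i))
    (h_indep : iIndepFun (fun i ω => (X i ω, Y i ω)) P)
    (h_ident : ∀ i, IdentDistrib (fun ω => (X i ω, Y i ω)) (fun ω => (X 0 ω, Y 0 ω)) P P) :
    TendstoInMeasure P
      (fun (n : ℕ) ω =>
        (∑ i ∈ Finset.range n, (Set.Iic x).indicator (1 : (Fin d → ℝ) → ℝ) (X i ω)) / n)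
      atTop (fun _ => probInput P (X 0) x) := by
  have hφ : Measurable fun w : (Fin d → ℝ) × ℝ => (Set.Iic x).indicator (1 : (Fin d → ℝ) → ℝ) w.1 :=
    (measurable_one.indicator measurableSet_Iic).comp measurable_fst
  have hm : ∀ i, Measurable fun ω => (Set.Iic x).indicator (1 : (Fin d → ℝ) → ℝ) (X i ω) := fun i =>
    (measurable_one.indicator measurableSet_Iic).comp (hX_meas i)
  refine tendstoInMeasure_of_tendsto_ae (fun n => ?_) ?_
  · exact ((Finset.measurable_fun_sum _ fun i _ => hm i).div_const _).aestronglyMeasurable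
  · have hint : Integrable (fun ω => (Set.Iic x).indicator (1 : (Fin d → ℝ) → ℝ) (X 0 ω)) P :=
      Integrable.of_bound (hm 0).aestronglyMeasurable 1 (ae_of_all _ fun ω => by
        by_cases h : X 0 ω ∈ Set.Iic x <;> simp [h])
    have hlln := strong_law_ae_real (μ := P)
      (fun i ω => (Set.Iic x).indicator (1 : (Fin d → ℝ) → ℝ) (X i ω)) hint
      (fun i j hij => ((h_indep.comp _ fun _ => hφ).indepFun hij)) fun i => (h_ident i).comp hφ
    have hmean : ∫ ω, (Set.Iic x).indicator (1 : (Fin d → ℝ) → ℝ) (X 0 ω) ∂P =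
        probInput P (X 0) x := by
      have : (fun ω => (Set.Iic x).indicator (1 : (Fin d → ℝ) → ℝ) (X 0 ω)) =
          (X 0 ⁻¹' Set.Iic x).indicator 1 := rfl
      rw [this, integral_indicator_one (hX_meas 0 measurableSet_Iic)]
      rfl
    rwa [hmean] at hlln

/-- `hIndex p κ - 1`, the index of an order statistic counted from zero, is the integer part of
`κ p`, and `κ p` is not an integer. -/
lemma sub_one_lt_of_hIndex {p κ : ℝ} (hpos : 0 < κ * p) (hint : ∀ j : ℤ, κ * p ≠ j) :
    ((hIndex p κ - 1 : ℕ) : ℝ) < κ * p ∧ κ * p < ((hIndex p κ - 1 : ℕ) : ℝ) + 1 := by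
  have h1 : 0 < hIndex p κ := Nat.ceil_pos.2 hpos
  refine ⟨Nat.lt_ceil.1 (Nat.sub_lt h1 one_pos), ?_⟩
  have h2 : κ * p ≤ hIndex p κ := Nat.le_ceil _
  have h3 : κ * p ≠ hIndex p κ := by
    have := hint (hIndex p κ)
    rwa [Int.cast_natCast] at this
  have h4 : ((hIndex p κ - 1 : ℕ) : ℝ) + 1 = hIndex p κ := by
    rw [← Nat.cast_add_one, Nat.sub_add_cancel h1]
  rw [h4]
  exact lt_of_le_of_ne h2 h3

/-- With probability tending to one, the sample quantile at the extreme level `1 - κ / n` is the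
`⌈κ p₀⌉`-th largest output among the observations with input at most `x`. -/
lemma tendsto_measure_qhat_ne_kthLargest [IsProbabilityMeasure P] {X : ℕ → Ω → Fin d → ℝ}
    {Y : ℕ → Ω → ℝ} (x : Fin d → ℝ)
    (hY0 : ∀ i ω, 0 ≤ Y i ω) (hX_meas : ∀ i, Measurable (X i))
    (h_indep : iIndepFun (fun i ω => (X i ω, Y i ω)) P)
    (h_ident : ∀ i, IdentDistrib (fun ω => (X i ω, Y i ω)) (fun ω => (X 0 ω, Y 0 ω)) P P)
    {p₀ : ℝ} (hp₀_def : p₀ = probInput P (X 0) x) (hp₀ : 0 < p₀)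
    {ι : Type*} [Finite ι] (κ : ι → ℝ) (hκ : ∀ a, 0 < κ a) (hint : ∀ a, ∀ j : ℤ, κ a * p₀ ≠ j)
    {qhat : ℕ → ℝ → Ω → ℝ} (hqhat : IsQuantileEstimator P X Y x qhat) :
    Tendsto (fun n : ℕ => P {ω | ¬ ∀ a, qhat n (1 - κ a / n) ω =
      kthLargest (fun i : Fin n => maskedOutput x (X i ω, Y i ω)) (hIndex p₀ (κ a) - 1)})
      atTop (𝓝 0) := by
  classical
  have hnear : ∀ᶠ y in 𝓝 p₀, ∀ a, ((hIndex p₀ (κ a) - 1 : ℕ) : ℝ) < κ a * y ∧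
      κ a * y < ((hIndex p₀ (κ a) - 1 : ℕ) : ℝ) + 1 := by
    refine eventually_all.2 fun a => ?_
    have h := sub_one_lt_of_hIndex (mul_pos (hκ a) hp₀) (hint a)
    have hc : Tendsto (fun y => κ a * y) (𝓝 p₀) (𝓝 (κ a * p₀)) :=
      (continuous_const_mul (κ a)).tendsto p₀
    exact (hc.eventually (lt_mem_nhds h.1)).and (hc.eventually (gt_mem_nhds h.2))
  obtain ⟨ε, hε, hball⟩ := Metric.eventually_nhds_iff.1 hnear
  have hshare := tendstoInMeasure_iff_dist.1
    (tendstoInMeasure_share x hX_meas h_indep h_ident) ε hε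
  refine tendsto_of_tendsto_of_tendsto_of_le_of_le' tendsto_const_nhds hshare
    (.of_forall fun _ => zero_le) ?_
  have hlarge : ∀ᶠ n : ℕ in atTop, ∀ a, κ a < n := by
    refine eventually_all.2 fun a => ?_
    filter_upwards [eventually_gt_atTop ⌈κ a⌉₊] with n hn
    exact (Nat.le_ceil _).trans_lt (by exact_mod_cast hn)
  filter_upwards [hlarge, eventually_gt_atTop 0] with n hn hn0
  have hn0' : (0 : ℝ) < n := by exact_mod_cast hn0
  have hmin : ∀ᵐ ω ∂P, ∀ a, ∀ q, quantileObjective X Y x n (1 - κ a / n) ω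
      (qhat n (1 - κ a / n) ω) ≤ quantileObjective X Y x n (1 - κ a / n) ω q := by
    have : Countable ι := Finite.to_countable
    refine eventually_countable_forall.2 fun a => hqhat.2 n _ ⟨?_, ?_⟩
    · rw [sub_pos, div_lt_one hn0']
      exact hn a
    · have := div_pos (hκ a) hn0'
      linarith
  refine measure_mono_ae ?_
  filter_upwards [hmin] with ω hω hbad
  by_contra hgood
  apply hbad
  intro a
  have hd : dist ((∑ i ∈ Finset.range n,
      (Set.Iic x).indicator (1 : (Fin d → ℝ) → ℝ) (X i ω)) / n) p₀ < ε := by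
    rw [hp₀_def]
    exact not_le.1 hgood
  have hcount : ∑ i ∈ Finset.range n, (Set.Iic x).indicator (1 : (Fin d → ℝ) → ℝ) (X i ω) =
      (Finset.univ.filter fun i : Fin n => X i ω ≤ x).card := by
    rw [Finset.sum_range, Finset.card_filter, Nat.cast_sum]
    refine Finset.sum_congr rfl fun i _ => ?_
    by_cases h : X i ω ≤ x <;> simp [Set.indicator, h]
  have hb := hball hd a
  rw [hcount] at hb
  have hres := kthLargest_eq_of_isMinOn (fun i : Fin n => X i ω ≤ x) (fun i => Y i ω)
    (fun i _ => hY0 i ω) (κ a) (qhat n (1 - κ a / n) ω) (hn a) (hIndex p₀ (κ a) - 1)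
    (fun q => by
      rw [← quantileObjective_eq_sum_filter, ← quantileObjective_eq_sum_filter]
      exact hω a q) hb.1 hb.2
  rw [hres]
  congr 1

/-- The tail of the masked output is the tail of the conditional distribution of the output,
multiplied by the probability of a small input. -/
lemma measureReal_maskedOutput_Ioi [IsProbabilityMeasure P] {X : Ω → Fin d → ℝ} {Y : Ω → ℝ}
    (hX : Measurable X) (hY : Measurable Y) {x : Fin d → ℝ} (hp : 0 < probInput P X x)
    {y : ℝ} (hy : -1 ≤ y) :
    (P.map fun ω => maskedOutput x (X ω, Y ω)).real (Set.Ioi y) =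
      probInput P X x * (1 - outputCDF P X Y x y) := by
  have hA : MeasurableSet {ω | X ω ≤ x} := hX measurableSet_Iic
  have hA0 : P {ω | X ω ≤ x} ≠ 0 := fun h => by
    rw [probInput, measureReal_def, h] at hp
    simp at hp
  have hprob := cond_isProbabilityMeasure hA0
  have hB : MeasurableSet {ω | Y ω ≤ y} := hY measurableSet_Iic
  have hV : Measurable fun ω => maskedOutput x (X ω, Y ω) :=
    (measurable_maskedOutput x).comp (hX.prodMk hY)
  rw [map_measureReal_apply hV measurableSet_Ioi,
    outputCDF, ← probReal_compl_eq_one_sub hB, measureReal_def (cond P _), cond_apply hA,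
    ENNReal.toReal_mul, ENNReal.toReal_inv, ← measureReal_def, ← measureReal_def, ← mul_assoc]
  change _ = probInput P X x * (probInput P X x)⁻¹ * _
  rw [mul_inv_cancel₀ hp.ne', one_mul]
  congr 1
  ext ω
  by_cases h : X ω ≤ x
  · simp [maskedOutput, h]
  · simp [maskedOutput, h, hy]

/-- The two descriptions of the upper endpoint, as a `1`-quantile and as the supremum of the points
with `F < 1`, agree. -/
lemma csInf_eq_csSup_of_monotone {F : ℝ → ℝ} (hF : Monotone F) (hne : {z | F z < 1}.Nonempty)
    (hb : BddAbove {z | F z < 1}) : sInf {y | 1 ≤ F y} = sSup {z | F z < 1} := by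
  obtain ⟨b, hb'⟩ := hb
  have hle : ∀ a ∈ {z | F z < 1}, ∀ c ∈ {y | 1 ≤ F y}, a ≤ c := by
    intro a ha c hc
    by_contra! h
    exact absurd (hc.trans (hF h.le)) (not_le.2 ha)
  have hne' : {y | 1 ≤ F y}.Nonempty := by
    refine ⟨b + 1, ?_⟩
    by_contra h
    have := hb' (show F (b + 1) < 1 from not_le.1 h)
    linarith
  refine le_antisymm ?_ (csSup_le hne fun a ha => le_csInf hne' fun c hc => hle a ha c hc)
  by_contra! h
  obtain ⟨c, h1, h2⟩ := exists_between h
  rcases lt_or_ge (F c) 1 with hc | hc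
  · exact absurd (le_csSup ⟨b, hb'⟩ hc) (not_le.2 h1)
  · obtain ⟨a, ha⟩ := hne
    exact absurd (csInf_le ⟨a, fun c hc => hle a ha c hc⟩ hc) (not_le.2 h2)

/-- The masked output inherits the upper endpoint and the regular variation of the tail at the
endpoint from the conditional distribution of the output. -/
lemma maskedOutput_tail [IsProbabilityMeasure P] {X : Ω → Fin d → ℝ} {Y : Ω → ℝ}
    (hX : Measurable X) (hY : Measurable Y) (hY0 : ∀ ω, 0 ≤ Y ω) {x : Fin d → ℝ}
    (hp : 0 < probInput P X x) {ξ₀ : ℝ} (hEV : InTypeIIIDomain (outputCDF P X Y x) ξ₀) {q₁ : ℝ}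
    (hq₁ : q₁ = quantile (outputCDF P X Y x) 1) :
    (∀ y < q₁, 0 < (P.map fun ω => maskedOutput x (X ω, Y ω)).real (Set.Ioi y)) ∧
    ∀ v : ℝ, 0 < v → Tendsto (fun z : ℝ =>
      (P.map fun ω => maskedOutput x (X ω, Y ω)).real (Set.Ioi (q₁ - v * z)) /
      (P.map fun ω => maskedOutput x (X ω, Y ω)).real (Set.Ioi (q₁ - z))) (𝓝[>] 0)
        (𝓝 (v ^ (-1 / ξ₀))) := by
  set ν := P.map fun ω => maskedOutput x (X ω, Y ω) with hν
  set F := outputCDF P X Y x with hF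
  have hνp : IsProbabilityMeasure ν := Measure.isProbabilityMeasure_map
    ((measurable_maskedOutput x).comp (hX.prodMk hY)).aemeasurable
  have hA0 : P {ω | X ω ≤ x} ≠ 0 := fun h => by
    rw [probInput, measureReal_def, h] at hp
    simp at hp
  have hprob := cond_isProbabilityMeasure hA0
  have hmono : Monotone F := fun a b hab =>
    measureReal_mono fun ω (hω : Y ω ≤ a) => hω.trans hab
  have hneg : ∀ y < 0, F y = 0 := by
    intro y hy
    have : {ω | Y ω ≤ y} = ∅ := by
      ext ω
      simpa using hy.trans_le (hY0 ω)
    rw [hF, outputCDF, this, measureReal_empty]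
  have hne : {z | F z < 1}.Nonempty := ⟨-1, by
    change F (-1) < 1
    rw [hneg _ (by norm_num)]
    exact one_pos⟩
  obtain ⟨-, hbdd, hRV⟩ := hEV
  have hqs : q₁ = sSup {z | F z < 1} := by
    rw [hq₁, quantile, csInf_eq_csSup_of_monotone hmono hne hbdd]
  have hq0 : 0 ≤ q₁ := by
    refine le_of_forall_lt fun y hy => ?_
    obtain ⟨y', h1, h2⟩ := exists_between hy
    refine h1.trans_le ?_
    rw [hqs]
    refine le_csSup hbdd ?_
    change F y' < 1
    rw [hneg _ h2]
    exact one_pos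
  have htail : ∀ y, -1 ≤ y → ν.real (Set.Ioi y) = probInput P X x * (1 - F y) := fun y hy =>
    measureReal_maskedOutput_Ioi hX hY hp hy
  constructor
  · have hpos : ∀ y < q₁, -1 ≤ y → 0 < ν.real (Set.Ioi y) := by
      intro y hy hy1
      rw [htail y hy1]
      rw [hqs] at hy
      obtain ⟨a, ha, hya⟩ := exists_lt_of_lt_csSup hne hy
      exact mul_pos hp (sub_pos.2 ((hmono hya.le).trans_lt ha))
    intro y hy
    exact (hpos (max y (-1)) (max_lt hy (by linarith)) (le_max_right _ _)).trans_le
      (antitone_measureReal_Ioi ν (le_max_left _ _))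
  · intro v hv
    have h := hRV v hv
    rw [← hqs] at h
    refine h.congr' ?_
    filter_upwards [Ioo_mem_nhdsGT (zero_lt_one' ℝ), Ioo_mem_nhdsGT (inv_pos.2 hv)] with z hz hz'
    have hvz : v * z < 1 := by
      calc v * z < v * v⁻¹ := by gcongr; exact hz'.2
        _ = 1 := mul_inv_cancel₀ hv.ne'
    rw [htail _ (by linarith), htail _ (by linarith [hz.2]), mul_div_mul_left _ _ hp.ne']

end Sample

/-! ### The limit variables -/

section LimitVariables

variable {Ω' : Type*} {E : ℕ → Ω' → ℝ}

lemma ae_forall_pos [MeasurableSpace Ω'] {P' : Measure Ω'}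
    (hE_law : ∀ i, HasLaw (E i) (expMeasure 1) P') :
    ∀ᵐ ω ∂P', ∀ i, 0 < E i ω := by
  refine eventually_countable_forall.2 fun i => ?_
  refine ((hE_law i).ae_iff (p := fun y => 0 < y) measurableSet_Ioi.mem).2 ?_
  rw [expMeasure_one_eq, ae_withDensity_iff measurable_expDensity]
  refine ae_of_all _ fun y hy => ?_
  by_contra h
  exact hy (if_neg h)

lemma aemeasurable_limitZ [MeasurableSpace Ω'] {P' : Measure Ω'}
    (hE : ∀ i, AEMeasurable (E i) P') (θ : ℝ × ℝ) (k : ℝ) :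
    AEMeasurable (limitZ E θ k) P' :=
  ((Finset.aemeasurable_fun_sum _ fun i _ => (hE i).div_const _).pow_const _).neg

lemma limitZ_eq (E : ℕ → Ω' → ℝ) (ξ p k : ℝ) (hk : 0 < k * p) (ω : Ω') :
    limitZ E (ξ, p) k ω =
      -(((∑ i ∈ Finset.range (hIndex p k - 1 + 1), E i ω) / p) ^ (-ξ)) := by
  have h : 0 < hIndex p k := Nat.ceil_pos.2 hk
  rw [Nat.sub_add_cancel h, Finset.sum_div]
  rfl

lemma limitZ_lt_limitZ {ξ p k k' : ℝ} (hξ : ξ < 0) (hp : 0 < p) (h : hIndex p k < hIndex p k')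
    {ω : Ω'} (hE : ∀ i, 0 < E i ω) : limitZ E (ξ, p) k' ω < limitZ E (ξ, p) k ω := by
  refine neg_lt_neg (Real.rpow_lt_rpow ?_ ?_ (by simpa using hξ))
  · exact Finset.sum_nonneg fun i _ => (div_pos (hE i) hp).le
  · refine Finset.sum_lt_sum_of_subset (i := hIndex p k)
      (Finset.range_subset_range.2 h.le) (Finset.mem_range.2 h) (by simp)
      (div_pos (hE _) hp) fun i _ _ => (div_pos (hE i) hp).le

lemma hIndex_lt_hIndex {p k k' : ℝ} (hk : 0 ≤ k * p) (h : k * p + 1 < k' * p) :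
    hIndex p k < hIndex p k' := by
  have h1 : (hIndex p k : ℝ) < k * p + 1 := Nat.ceil_lt_add_one hk
  have h2 : k' * p ≤ hIndex p k' := Nat.le_ceil _
  exact_mod_cast h1.trans (h.trans_le h2)

end LimitVariables

/-! ### The Bayes estimator -/

/-- The relation between the statistics `(t, z, θ)` and a normalized estimation error `e`: here
`t` stands for the normalized top order statistics `(Y₍ⱼ₎ - q₁) / z`, and `q₁ + s * e`, with
`s = z * (t a₀ - t a₁)` the inverse of the feasible normalizing factor, minimizes the posterior
risk. Nothing is required when `t a₀ ≤ t a₁`. -/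
def BayesRelation {J L : ℕ} (ρ prior : ℝ → ℝ) (f : ℝ × ℝ → (Fin L → ℝ) → ℝ) (q₁ : ℝ)
    (a₀ a₁ : Fin (J + 1)) (a : Fin L → Fin (J + 1))
    (v : (Fin (J + 1) → ℝ) × ℝ × ℝ × ℝ) (e : ℝ) : Prop :=
  0 < v.2.1 ∧ (v.1 a₁ < v.1 a₀ → ∀ y,
    posteriorRisk ρ prior (f v.2.2) (v.2.1 * (v.1 a₀ - v.1 a₁))⁻¹
        (fun l => q₁ + v.2.1 * v.1 (a l)) (q₁ + v.2.1 * (v.1 a₀ - v.1 a₁) * e) ≤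
      posteriorRisk ρ prior (f v.2.2) (v.2.1 * (v.1 a₀ - v.1 a₁))⁻¹
        (fun l => q₁ + v.2.1 * v.1 (a l)) (q₁ + v.2.1 * (v.1 a₀ - v.1 a₁) * y))

/-- Deterministic core of the argument: along a convergent sequence of statistics, the normalized
errors of the minimizers of the posterior risk converge to the minimizer of the limiting risk. -/
lemma tendsto_of_bayesRelation {J L : ℕ} {ρ prior : ℝ → ℝ} {f : ℝ × ℝ → (Fin L → ℝ) → ℝ}
    {θ₀ : ℝ × ℝ} {B r C Cp Cρ q₁ : ℝ} {a₀ a₁ : Fin (J + 1)} {a : Fin L → Fin (J + 1)}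
    (hρ : Measurable ρ) (hρ0 : ∀ u, 0 ≤ ρ u) (hρc : ConvexOn ℝ Set.univ ρ)
    (hρ_growth : ∀ u, ρ u ≤ Cρ * (1 + |u| ^ B)) (l : Fin L)
    (hfm : ∀ᶠ θ in 𝓝 θ₀, Measurable (f θ)) (hf0 : ∀ᶠ θ in 𝓝 θ₀, ∀ x, 0 ≤ f θ x)
    (hf_cont : ∀ x : Fin L → ℝ,
      ContinuousAt (fun p : (ℝ × ℝ) × (Fin L → ℝ) => f p.1 p.2) (θ₀, x))
    (hB : 0 ≤ B) (hr : B + 1 < r)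
    (hdecay : ∀ᶠ θ in 𝓝 θ₀, ∀ x : Fin L → ℝ, f θ x ≤ C * (1 + |x l|) ^ (-r))
    (hprior : Measurable prior) (hprior0 : ∀ t, 0 ≤ prior t) (hpriorb : ∀ t, prior t ≤ Cp)
    (hpriorc : ContinuousAt prior q₁) (hprior_pos : 0 < prior q₁)
    {t : Fin (J + 1) → ℝ} (ht : t a₁ < t a₀) {w₀ : Fin L → ℝ}
    (hw₀ : ∀ l, w₀ l = t (a l) / (t a₀ - t a₁))
    (hpos : ∫⁻ v, ENNReal.ofReal (f θ₀ fun l => w₀ l - v) ≠ 0) {z₀ : ℝ}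
    (hmin : ∀ z, z ≠ z₀ → limitRisk ρ (f θ₀) w₀ z₀ < limitRisk ρ (f θ₀) w₀ z)
    {v : ℕ → (Fin (J + 1) → ℝ) × ℝ × ℝ × ℝ} {e : ℕ → ℝ}
    (hv : Tendsto v atTop (𝓝 (t, 0, θ₀)))
    (he : ∀ j, BayesRelation ρ prior f q₁ a₀ a₁ a (v j) (e j)) :
    Tendsto e atTop (𝓝 z₀) := by
  have hv1 : ∀ b, Tendsto (fun j => (v j).1 b) atTop (𝓝 (t b)) := fun b =>
    (tendsto_pi_nhds.1 ((continuous_fst.tendsto _).comp hv)) b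
  have hv2 : Tendsto (fun j => (v j).2) atTop (𝓝 (0, θ₀)) := (continuous_snd.tendsto _).comp hv
  have hz : Tendsto (fun j => (v j).2.1) atTop (𝓝 0) := (continuous_fst.tendsto _).comp hv2
  have hθ : Tendsto (fun j => (v j).2.2) atTop (𝓝 θ₀) := (continuous_snd.tendsto _).comp hv2
  have hdiff := (hv1 a₀).sub (hv1 a₁)
  have hne : t a₀ - t a₁ ≠ 0 := (sub_pos.2 ht).ne'
  set s : ℕ → ℝ := fun j => (v j).2.1 * ((v j).1 a₀ - (v j).1 a₁) with hs_def
  have hs : Tendsto s atTop (𝓝 0) := by simpa using hz.mul hdiff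
  have hlt : ∀ᶠ j in atTop, (v j).1 a₁ < (v j).1 a₀ := (hv1 a₁).eventually_lt (hv1 a₀) ht
  have hs0 : ∀ᶠ j in atTop, 0 < s j := by
    filter_upwards [hlt] with j hj using mul_pos (he j).1 (sub_pos.2 hj)
  set w : ℕ → Fin L → ℝ := fun j l => (v j).1 (a l) / ((v j).1 a₀ - (v j).1 a₁) with hw_def
  have hw : Tendsto w atTop (𝓝 w₀) := tendsto_pi_nhds.2 fun l => by
    rw [hw₀]
    exact (hv1 (a l)).div hdiff hne
  have hsw : ∀ᶠ j in atTop, (fun l => q₁ + s j * w j l) =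
      fun l => q₁ + (v j).2.1 * (v j).1 (a l) := by
    filter_upwards [hlt] with j hj
    ext l
    have : (v j).1 a₀ - (v j).1 a₁ ≠ 0 := (sub_pos.2 hj).ne'
    simp only [hs_def, hw_def]
    field_simp
  refine tendsto_of_isMin_of_segment
    (Q := fun j y => posteriorRisk ρ prior (f (v j).2.2) (s j)⁻¹ (fun l => q₁ + s j * w j l)
      (q₁ + s j * y)) ?_ (fun z => tendsto_posteriorRisk hρ hρ0 hρ_growth l hfm hf0 hf_cont hB hr
      hdecay hprior hprior0 hpriorb hpriorc hprior_pos hs hs0 hw hθ hpos z) hmin ?_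
  · filter_upwards [hθ.eventually hfm] with j hj b c z hz hbc
    exact posteriorRisk_le_of_mem_segment hρ hρ0 hρc hprior hj _ q₁ (s j) _ hz hbc
  · filter_upwards [hlt, hsw] with j hj hj'
    simp only [hj']
    exact (he j).2 hj z₀

end Frontier

theorem mainTheorem4
    -- the sample, the technology and the input level
    {Ω : Type*} [MeasurableSpace Ω] (P : Measure Ω) [IsProbabilityMeasure P]
    {d : ℕ} (T : Set ((Fin d → ℝ) × ℝ))
    (hT : Frontier.IsTechnology T) (hFD : Frontier.FreeDisposal T)
    (X : ℕ → Ω → Fin d → ℝ) (Y : ℕ → Ω → ℝ) (x : Fin d → ℝ) (hx : 0 ≤ x)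
    (hXY_mem : ∀ i ω, (X i ω, Y i ω) ∈ T)
    (hX_meas : ∀ i, Measurable (X i)) (hY_meas : ∀ i, Measurable (Y i))
    (h_indep : iIndepFun (fun i ω => (X i ω, Y i ω)) P)
    (h_ident : ∀ i, IdentDistrib (fun ω => (X i ω, Y i ω)) (fun ω => (X 0 ω, Y 0 ω)) P P)
    (p₀ : ℝ) (hp₀_def : p₀ = Frontier.probInput P (X 0) x) (hp₀ : 0 < p₀)
    -- extreme value condition, and the upper endpoint `q(1)`
    (ξ₀ : ℝ) (hEV : Frontier.InTypeIIIDomain (Frontier.outputCDF P (X 0) (Y 0) x) ξ₀)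
    (q₁ : ℝ) (hq₁ : q₁ = Frontier.quantile (Frontier.outputCDF P (X 0) (Y 0) x) 1)
    -- tuning constants
    (k₀ m : ℝ) (hk₀ : 0 < k₀) (hm : 1 < m) {L : ℕ} (hL : 0 < L)
    (k : Fin L → ℝ) (hk : ∀ l, 0 < k l)
    (hk₀_int : ∀ j : ℤ, k₀ * p₀ ≠ j) (hmk₀_int : ∀ j : ℤ, m * k₀ * p₀ ≠ j)
    (hk_int : ∀ l, ∀ j : ℤ, k l * p₀ ≠ j)
    (hmk₀ : k₀ * p₀ + 1 < m * k₀ * p₀)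
    (h_distinct : Function.Injective
      (Matrix.vecCons (Frontier.hIndex p₀ k₀) (Matrix.vecCons (Frontier.hIndex p₀ (m * k₀))
        (fun l => Frontier.hIndex p₀ (k l)))))
    -- the exponential variables that build the limit
    {Ω' : Type*} [MeasurableSpace Ω'] (P' : Measure Ω') [IsProbabilityMeasure P']
    (E : ℕ → Ω' → ℝ) (hE_law : ∀ i, HasLaw (E i) (expMeasure 1) P') (hE_indep : iIndepFun E P')
    -- the family of limiting densities
    (f : ℝ × ℝ → (Fin L → ℝ) → ℝ)
    (hf : ∀ᶠ θ in 𝓝 (ξ₀, p₀), Frontier.IsLimitDensity P' E k₀ m k θ (f θ))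
    (hf_cont : ∀ z : Fin L → ℝ,
      ContinuousAt (fun w : (ℝ × ℝ) × (Fin L → ℝ) => f w.1 w.2) ((ξ₀, p₀), z))
    -- the loss, of growth order at most `B`, and the decay of the densities
    (ρ : ℝ → ℝ) (hρ_nonneg : ∀ u, 0 ≤ ρ u) (hρ_convex : ConvexOn ℝ Set.univ ρ)
    (B : ℝ) (hB : 0 ≤ B) (hρ_growth : ∃ C : ℝ, ∀ u, ρ u ≤ C * (1 + |u| ^ B))
    (hf_decay : ∃ r C : ℝ, B + 1 < r ∧
      ∀ᶠ θ in 𝓝 (ξ₀, p₀), ∀ z : Fin L → ℝ, ∀ l, f θ z ≤ C * (1 + |z l|) ^ (-r))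
    -- the prior
    (prior : ℝ → ℝ) (hprior_meas : Measurable prior) (hprior_nonneg : ∀ t, 0 ≤ prior t)
    (hprior_bdd : ∃ C : ℝ, ∀ t, prior t ≤ C) (hprior_cont : ContinuousAt prior q₁)
    (hprior_supp : q₁ ∈ interior (Function.support prior))
    -- the estimators
    (ξhat phat : ℕ → Ω → ℝ)
    (hξhat_meas : ∀ n, AEMeasurable (ξhat n) P) (hphat_meas : ∀ n, AEMeasurable (phat n) P)
    (hξhat : TendstoInMeasure P ξhat atTop (fun _ => ξ₀))
    (hphat : TendstoInMeasure P phat atTop (fun _ => p₀))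
    (qhat : ℕ → ℝ → Ω → ℝ) (hqhat : Frontier.IsQuantileEstimator P X Y x qhat)
    (qBE : ℕ → Ω → ℝ) (hqBE_meas : ∀ n, AEMeasurable (qBE n) P)
    (hqBE : Tendsto (fun n : ℕ => P {ω | ¬ ∀ q,
        Frontier.posteriorRisk ρ prior (f (ξhat n ω, phat n ω)) (Frontier.alphaHat qhat k₀ m n ω)
            (fun l => qhat n (1 - k l / n) ω) (qBE n ω) ≤
          Frontier.posteriorRisk ρ prior (f (ξhat n ω, phat n ω)) (Frontier.alphaHat qhat k₀ m n ω)
            (fun l => qhat n (1 - k l / n) ω) q}) atTop (𝓝 0))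
    -- the limiting risk is finite on an open set and has a unique minimizer, almost surely
    (hQ_finite : ∃ Z₀ : Set ℝ, IsOpen Z₀ ∧ Z₀.Nonempty ∧ ∀ᵐ ω ∂P', ∀ z ∈ Z₀,
      Frontier.limitRisk ρ (f (ξ₀, p₀))
        (fun l => Frontier.limitZTilde E k₀ m (ξ₀, p₀) (k l) ω) z ≠ ∞)
    (ZBE : Ω' → ℝ) (hZBE_meas : AEMeasurable ZBE P')
    (hZBE : ∀ᵐ ω ∂P', ∀ z, z ≠ ZBE ω →
      Frontier.limitRisk ρ (f (ξ₀, p₀))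
          (fun l => Frontier.limitZTilde E k₀ m (ξ₀, p₀) (k l) ω) (ZBE ω) <
        Frontier.limitRisk ρ (f (ξ₀, p₀))
          (fun l => Frontier.limitZTilde E k₀ m (ξ₀, p₀) (k l) ω) z) :
    TendstoInDistribution
      (fun (n : ℕ) ω => Frontier.alphaHat qhat k₀ m n ω * (qBE n ω - q₁)) atTop ZBE
      (fun _ => P) P' := by
  have hξ₀ : ξ₀ < 0 := hEV.1
  have hp₀' : 0 < Frontier.probInput P (X 0) x := hp₀_def ▸ hp₀
  have hY0 : ∀ i ω, 0 ≤ Y i ω := fun i ω => (hT _ (hXY_mem i ω)).2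
  -- All extreme levels, `k₀`, `m k₀` and `k l`, in one family.
  set κ : Fin L ⊕ Bool → ℝ := Sum.elim k fun b => if b then m * k₀ else k₀ with hκ_def
  have hκ : ∀ a, 0 < κ a := by
    rintro (l | b)
    · exact hk l
    · cases b
      · exact hk₀
      · exact mul_pos (one_pos.trans hm) hk₀
  have hκ_int : ∀ a, ∀ j : ℤ, κ a * p₀ ≠ j := by
    rintro (l | b)
    · exact hk_int l
    · cases b
      · exact hk₀_int
      · exact hmk₀_int
  have hκp : ∀ a, 0 < κ a * p₀ := fun a => mul_pos (hκ a) hp₀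
  set J : ℕ := ∑ a, Frontier.hIndex p₀ (κ a) with hJ_def
  have hJ : ∀ a, Frontier.hIndex p₀ (κ a) - 1 < J + 1 := fun a => by
    have := Finset.single_le_sum (f := fun a => Frontier.hIndex p₀ (κ a))
      (fun _ _ => Nat.zero_le _) (Finset.mem_univ a)
    have h' : Frontier.hIndex p₀ (κ a) ≤ J := this
    omega
  set idx : Fin L ⊕ Bool → Fin (J + 1) := fun a => ⟨Frontier.hIndex p₀ (κ a) - 1, hJ a⟩
    with hidx
  -- The masked sample, its law and the regular variation of its tail quantile function.
  set V : ℕ → Ω → ℝ := fun i ω => Frontier.maskedOutput x (X i ω, Y i ω) with hV_def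
  set ν : Measure ℝ := P.map (V 0) with hν_def
  have hVm : ∀ i, Measurable (V i) := fun i =>
    (Frontier.measurable_maskedOutput x).comp ((hX_meas i).prodMk (hY_meas i))
  have hν : IsProbabilityMeasure ν := Measure.isProbabilityMeasure_map (hVm 0).aemeasurable
  have hV_law : ∀ i, HasLaw (V i) ν P := fun i =>
    ⟨(hVm i).aemeasurable, ((h_ident i).comp (Frontier.measurable_maskedOutput x)).map_eq⟩
  have hV_indep : iIndepFun V P :=
    h_indep.comp _ fun _ => Frontier.measurable_maskedOutput x
  have hexp : 0 < -1 / ξ₀ := div_pos_of_neg_of_neg (by norm_num) hξ₀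
  obtain ⟨hpos, hRV⟩ :=
    Frontier.maskedOutput_tail (hX_meas 0) (hY_meas 0) (hY0 0) hp₀' hEV hq₁
  have hlevel : Tendsto (fun n : ℕ => p₀ / (n : ℝ)) atTop (𝓝[>] 0) := by
    refine tendsto_nhdsWithin_iff.2 ⟨tendsto_const_div_atTop_nhds_zero_nat p₀, ?_⟩
    filter_upwards [eventually_gt_atTop 0] with n hn
    exact Set.mem_Ioi.2 (div_pos hp₀ (by exact_mod_cast hn))
  set z : ℕ → ℝ := fun n => q₁ - Frontier.tailQuantile ν (p₀ / n) with hz_def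
  have hz : Tendsto z atTop (𝓝[>] 0) :=
    (Frontier.tendsto_sub_tailQuantile ν hexp hpos hRV).comp hlevel
  have hz0 : ∀ᶠ n in atTop, 0 < z n := (tendsto_nhdsWithin_iff.1 hz).2
  have hlim : ∀ u : ℝ, 0 < u → Tendsto
      (fun n : ℕ => (Frontier.tailQuantile ν (u / n) - q₁) / z n) atTop
      (𝓝 (-((u / p₀) ^ (-ξ₀)))) := by
    intro u hu
    have h := (Frontier.tendsto_tailQuantile_ratio ν hexp hpos hRV (div_pos hu hp₀)).comp hlevel
    rw [inv_div, div_neg, div_one] at h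
    refine h.congr fun n => ?_
    have h1 : u / p₀ * (p₀ / (n : ℝ)) = u / n := div_mul_div_cancel₀ hp₀.ne'
    simp only [Function.comp_apply, h1, hz_def]
  have hTconv := Frontier.tendstoInDistribution_kthLargest hV_law hV_indep hE_law hE_indep J q₁ z
    (fun u => -((u / p₀) ^ (-ξ₀))) (by fun_prop) hlim
  have hθ : TendstoInMeasure P (fun n ω => (z n, (ξhat n ω, phat n ω))) atTop
      (fun _ => ((0 : ℝ), (ξ₀, p₀))) := by
    refine Frontier.tendstoInMeasure_prodMk (u := fun n _ => z n) ?_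
      (Frontier.tendstoInMeasure_prodMk hξhat hphat)
    exact tendstoInMeasure_of_tendsto_ae (fun n => aestronglyMeasurable_const)
      (ae_of_all _ fun _ => (tendsto_nhdsWithin_iff.1 hz).1)
  have hVconv := hTconv.prodMk_of_tendstoInMeasure_const _ _ _ hθ fun n =>
    aemeasurable_const.prodMk ((hξhat_meas n).prodMk (hphat_meas n))
  obtain ⟨Cρ, hCρ⟩ := hρ_growth
  obtain ⟨r, C, hr, hdecay⟩ := hf_decay
  obtain ⟨Cp, hCp⟩ := hprior_bdd
  have hρ_cont : Continuous ρ :=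
    continuousOn_univ.1 (hρ_convex.continuousOn isOpen_univ)
  have hprior_pos : 0 < prior q₁ :=
    (hprior_nonneg q₁).lt_of_ne' (Function.mem_support.1 (interior_subset hprior_supp))
  have hf₀ := hf.self_of_nhds
  have hf₀_cont : Continuous (f (ξ₀, p₀)) := continuous_iff_continuousAt.2 fun y =>
    (hf_cont y).comp (f := fun y => ((ξ₀, p₀), y)) (by fun_prop)
  have hEm : ∀ i, AEMeasurable (E i) P' := fun i => (hE_law i).aemeasurable
  have hWm : AEMeasurable
      (fun ω l => Frontier.limitZTilde E k₀ m (ξ₀, p₀) (k l) ω) P' :=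
    aemeasurable_pi_lambda _ fun l => (Frontier.aemeasurable_limitZ hEm _ _).div
      ((Frontier.aemeasurable_limitZ hEm _ _).sub (Frontier.aemeasurable_limitZ hEm _ _))
  have hlt : Frontier.hIndex p₀ k₀ < Frontier.hIndex p₀ (m * k₀) :=
    Frontier.hIndex_lt_hIndex (mul_pos hk₀ hp₀).le hmk₀
  refine Frontier.tendstoInDistribution_of_relation hVconv (fun n => ?_) hZBE_meas
    (Frontier.BayesRelation ρ prior f q₁ (idx (Sum.inr false)) (idx (Sum.inr true))
      fun l => idx (Sum.inl l)) ?_ ?_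
  · exact ((hqhat.1 n _).sub (hqhat.1 n _)).inv.mul ((hqBE_meas n).sub_const q₁)
  · -- The relation holds as soon as the quantile estimators are the expected order statistics
    -- and `qBE n` minimizes the posterior risk.
    have hq := Frontier.tendsto_measure_qhat_ne_kthLargest x hY0 hX_meas h_indep h_ident hp₀_def
      hp₀ κ hκ hκ_int hqhat
    have hsum := hq.add hqBE
    rw [add_zero] at hsum
    refine tendsto_of_tendsto_of_tendsto_of_le_of_le' tendsto_const_nhds hsum
      (.of_forall fun _ => zero_le) ?_
    filter_upwards [hz0] with n hn
    refine le_trans (measure_mono fun ω hω => ?_) (measure_union_le _ _)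
    by_contra hgood
    rw [Set.mem_union, not_or] at hgood
    have hgq : ∀ a, qhat n (1 - κ a / n) ω =
        Frontier.kthLargest (fun i : Fin n => V i ω) (Frontier.hIndex p₀ (κ a) - 1) :=
      not_not.1 hgood.1
    have hgB := not_not.1 hgood.2
    refine hω ⟨hn, fun hdiff y => ?_⟩
    have hT_eq : ∀ a, q₁ + z n *
        ((Frontier.kthLargest (fun i : Fin n => V i ω) (idx a) - q₁) / z n) =
          qhat n (1 - κ a / n) ω := by
      intro a
      rw [hgq a, mul_div_cancel₀ _ hn.ne']
      exact add_sub_cancel _ _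
    have h0 := hT_eq (Sum.inr false)
    have h1 := hT_eq (Sum.inr true)
    have hα : Frontier.alphaHat qhat k₀ m n ω =
        (z n * ((Frontier.kthLargest (fun i : Fin n => V i ω) (idx (Sum.inr false)) - q₁) / z n -
          (Frontier.kthLargest (fun i : Fin n => V i ω) (idx (Sum.inr true)) - q₁) / z n))⁻¹ := by
      have h0' : κ (Sum.inr false) = k₀ := rfl
      have h1' : κ (Sum.inr true) = m * k₀ := rfl
      rw [h0'] at h0
      rw [h1'] at h1
      rw [Frontier.alphaHat, ← h0, ← h1]
      congr 1
      ring
    have hs : z n * ((Frontier.kthLargest (fun i : Fin n => V i ω) (idx (Sum.inr false)) - q₁) /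
        z n - (Frontier.kthLargest (fun i : Fin n => V i ω) (idx (Sum.inr true)) - q₁) / z n) ≠ 0 :=
      (mul_pos hn (sub_pos.2 hdiff)).ne'
    have hqv : (fun l => q₁ + z n *
        ((Frontier.kthLargest (fun i : Fin n => V i ω) (idx (Sum.inl l)) - q₁) / z n)) =
          fun l => qhat n (1 - k l / n) ω := funext fun l => hT_eq (Sum.inl l)
    simp only [hqv, ← hα]
    rw [hα, ← mul_assoc, mul_inv_cancel₀ hs, one_mul, add_sub_cancel, ← hα]
    exact hgB _
  · filter_upwards [Frontier.ae_forall_pos hE_law, hZBE,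
      Frontier.ae_lintegral_translate_ne_zero hf₀_cont hWm hf₀.2.2] with ω hEpos hmin hD v e hv he
    have hidx_eq : ∀ a, -(((∑ i ∈ Finset.range ((idx a : ℕ) + 1), E i ω) / p₀) ^ (-ξ₀)) =
        Frontier.limitZ E (ξ₀, p₀) (κ a) ω := fun a =>
      (Frontier.limitZ_eq E ξ₀ p₀ (κ a) (hκp a) ω).symm
    refine Frontier.tendsto_of_bayesRelation hρ_cont.measurable hρ_nonneg hρ_convex hCρ ⟨0, hL⟩
      (hf.mono fun θ h => h.1) (hf.mono fun θ h => h.2.1) hf_cont hB hr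
      (hdecay.mono fun θ h y => h y _) hprior_meas hprior_nonneg hCp hprior_cont hprior_pos
      ?_ (fun l => ?_) hD hmin hv he
    · rw [hidx_eq, hidx_eq]
      exact Frontier.limitZ_lt_limitZ hξ₀ hp₀ hlt hEpos
    · rw [hidx_eq, hidx_eq, hidx_eq]
      rfl
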